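/- **Theorem (Core-set).** There are absolute constants $C,K>0$ such that the following two statements hold for every $0<\varepsilon<1$ and every finite vertex set $V$ with $|V|=n$. In both, for a degree function $(d_i)_{i\in V}$ put $\Delta=\frac1n\sum_{i}d_i$ (the average degree), and for a parameter $\alpha>0$ let $$h_i=\min\Big\{1,\ \frac{\max\{d_i,\varepsilon\Delta\}}{\Delta^2\alpha}\Big\}$$ be the importance score of $i$. Let $p_i\in[h_i,2h_i]\cap[0,1]$ for every $i\in V$, and let $S\subseteq V$ be the random set that contains each vertex $i$ independently with probability $p_i$. 1. *(MaxCut)* Let $G=(V,E)$ be an unweighted simple graph with degrees $d_i$ and $\Delta>0$, and let $\alpha=\varepsilon^4/(C\log n)$. Let $H$ be the subgraph of $G$ induced on $S$, with weight $\frac{1}{p_ip_j\Delta^2}$ on each edge $ij$. For a weighted graph let $\mathrm{MaxCut}$ be the maximum, over partitions $(A,B)$ of its vertex set, of the total weight of the edges between $A$ and $B$ (the edges of $G$ have weight $1$). Then with probability at least $1-\frac1{n^2}$ both $$|S|\le K\,\frac{\log n}{\varepsilon^4}\cdot\frac n\Delta\qquad\text{and}\qquad \frac{\mathrm{MaxCut}(G)}{1+\varepsilon}\le\Delta^2\,\mathrm{MaxCut}(H)\le(1+\varepsilon)\,\mathrm{MaxCut}(G).$$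 2. *(Max-agree correlation clustering)* Let $G=(V,E,c^+,c^-)$ be a simple graph with symmetric edge weights $c^+_{ij},c^-_{ij}\in[0,1]$, at most one of which is nonzero on each edge. Let $d_i=\sum_{j:\,ij\in E}|c^+_{ij}-c^-_{ij}|$, assume $\Delta>0$, and let $\alpha=\varepsilon^8/(C\log n)$. Let $H$ be the subgraph of $G$ induced on $S$, with edge weights $\frac{c^+_{ij}}{p_ip_j\Delta^2}$ and $\frac{c^-_{ij}}{p_ip_j\Delta^2}$. Let $\mathrm{CC}$ be the maximum, over all partitions of the vertex set into clusters, of the sum of $c^+$ over the edges inside clusters plus the sum of $c^-$ over the edges between different clusters. Then with probability at least $1-\frac1{n^2}$ both $$|S|\le K\,\frac{\log n}{\varepsilon^8}\cdot\frac n\Delta\qquad\text{and}\qquad \frac{\mathrm{CC}(G)}{1+\varepsilon}\le\Delta^2\,\mathrm{CC}(H)\le(1+\varepsilon)\,\mathrm{CC}(G).$$ -/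

import Mathlib

noncomputable section

/-- A weighted undirected graph `(V, E, w)`: `graph` carries the edge set, and only the
values of `weight` on edges are ever used. -/
structure WeightedGraph (V : Type*) where
  graph : SimpleGraph V
  weight : V → V → ℝ
  weight_symm : ∀ i j, weight i j = weight j i
  weight_nonneg : ∀ i j, graph.Adj i j → 0 ≤ weight i j

namespace WeightedGraph

/-- An unweighted graph, seen as a weighted one: every edge has weight `1`. -/
def ofSimpleGraph {V : Type*} (G : SimpleGraph V) : WeightedGraph V where
  graph := G
  weight _ _ := 1
  weight_symm _ _ := rfl
  weight_nonneg _ _ _ := zero_le_one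

open Classical in
/-- `w(A, B)` for `B = V \ A`: the total weight of the edges between `A` and its complement.
Each such edge is counted once, from its endpoint in `A`. -/
def cutWeight {V : Type*} [Fintype V] (H : WeightedGraph V) (A : Set V) : ℝ :=
  ∑ i, ∑ j, if i ∈ A ∧ j ∉ A ∧ H.graph.Adj i j then H.weight i j else 0

/-- `MaxCut(H)`: the maximum of `w(A, B)` over all partitions `(A, B)` of the vertex set. -/
def maxCut {V : Type*} [Fintype V] (H : WeightedGraph V) : ℝ :=
  ⨆ A : Set V, H.cutWeight A

/-- The supremum in `maxCut` is a maximum. -/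
theorem isGreatest_maxCut {V : Type*} [Fintype V] (H : WeightedGraph V) :
    IsGreatest (Set.range H.cutWeight) H.maxCut := by
  obtain ⟨A, hA⟩ := exists_eq_ciSup_of_finite (f := H.cutWeight)
  exact ⟨⟨A, hA⟩, by
    rintro _ ⟨B, rfl⟩
    exact le_ciSup (Set.finite_range H.cutWeight).bddAbove B⟩

end WeightedGraph

/-- An instance `(V, E, c⁺, c⁻)` of correlation clustering. Only the values on edges are ever
used. -/
structure CorrelationGraph (V : Type*) where
  graph : SimpleGraph V
  cPos : V → V → ℝ
  cNeg : V → V → ℝ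
  cPos_symm : ∀ i j, cPos i j = cPos j i
  cNeg_symm : ∀ i j, cNeg i j = cNeg j i
  cPos_nonneg : ∀ i j, graph.Adj i j → 0 ≤ cPos i j
  cNeg_nonneg : ∀ i j, graph.Adj i j → 0 ≤ cNeg i j
  eq_zero_or_eq_zero : ∀ i j, graph.Adj i j → cPos i j = 0 ∨ cNeg i j = 0

namespace CorrelationGraph

open Classical in
/-- The degree `d_i = ∑_{j ∼ i} |η_ij|`, where `η = c⁺ - c⁻`. -/
def degree {V : Type*} [Fintype V] (G : CorrelationGraph V) (i : V) : ℝ :=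
  ∑ j, if G.graph.Adj i j then |G.cPos i j - G.cNeg i j| else 0

open Classical in
/-- The MAX-AGREE score of a clustering: the sum of `c⁺` over the edges inside clusters plus the
sum of `c⁻` over the edges between different clusters. The clusters are the classes of the
equivalence relation `r`; the factor `1 / 2` makes every edge count once. -/
def agreeScore {V : Type*} [Fintype V] (G : CorrelationGraph V) (r : Setoid V) : ℝ :=
  (1 / 2 : ℝ) * ∑ i, ∑ j,
    if G.graph.Adj i j then (if r i j then G.cPos i j else G.cNeg i j) else 0

/-- `CC(G)`: the maximum MAX-AGREE score over all partitions of `V` into clusters. -/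
def cc {V : Type*} [Fintype V] (G : CorrelationGraph V) : ℝ :=
  ⨆ r : Setoid V, G.agreeScore r

/-- The supremum in `cc` is a maximum. -/
theorem isGreatest_cc {V : Type*} [Fintype V] (G : CorrelationGraph V) :
    IsGreatest (Set.range G.agreeScore) G.cc := by
  have : Finite (Setoid V) := Finite.of_injective
    (fun r : Setoid V => (fun i j => r i j : V → V → Prop))
    (fun r s h => Setoid.ext fun i j => by
      have := congrFun (congrFun h i) j
      exact iff_of_eq this)
  obtain ⟨r, hr⟩ := exists_eq_ciSup_of_finite (f := G.agreeScore)
  exact ⟨⟨r, hr⟩, by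
    rintro _ ⟨s, rfl⟩
    exact le_ciSup (Set.finite_range G.agreeScore).bddAbove s⟩

end CorrelationGraph

open Classical in
/-- The degree of a vertex of an unweighted graph, as a real number. -/
def vertexDegree {V : Type*} [Fintype V] (G : SimpleGraph V) (i : V) : ℝ :=
  (G.degree i : ℝ)

/-- The average `Δ = (∑_i d_i) / n` of a degree function `d`. -/
def averageDegree {V : Type*} [Fintype V] (d : V → ℝ) : ℝ :=
  (∑ i, d i) / (Fintype.card V : ℝ)

/-- The importance score `h_i = min {1, max {d_i, ε Δ} / (Δ² α)}` for the degree function `d`. -/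
def importanceScore {V : Type*} [Fintype V] (d : V → ℝ) (ε α : ℝ) (i : V) : ℝ :=
  min 1 (max (d i) (ε * averageDegree d) / (averageDegree d ^ 2 * α))

/-- The weighted induced subgraph that vertex sampling produces when the sampled set is `S`: the
subgraph of `G` induced on `S`, with weight `1 / (p_i p_j Δ²)` on the edge `ij`. -/
def vertexSample {V : Type*} [Fintype V] (G : SimpleGraph V) (p : V → unitInterval)
    (S : Finset V) : WeightedGraph S where
  graph := G.induce (S : Set V)
  weight i j := 1 / ((p i : ℝ) * p j * averageDegree (vertexDegree G) ^ 2)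
  weight_symm i j := by rw [mul_comm (p i : ℝ)]
  weight_nonneg i j _ := by
    have hi := (p i).2.1
    have hj := (p j).2.1
    positivity

/-- Vertex sampling for correlation clustering: the subgraph of `G` induced on the sampled set
`S`, with both weights of the edge `ij` multiplied by `1 / (p_i p_j Δ²)`. -/
def CorrelationGraph.vertexSample {V : Type*} [Fintype V] (G : CorrelationGraph V)
    (p : V → unitInterval) (S : Finset V) : CorrelationGraph S where
  graph := G.graph.induce (S : Set V)
  cPos i j := 1 / ((p i : ℝ) * p j * averageDegree G.degree ^ 2) * G.cPos i j
  cNeg i j := 1 / ((p i : ℝ) * p j * averageDegree G.degree ^ 2) * G.cNeg i j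
  cPos_symm i j := by rw [mul_comm (p i : ℝ), G.cPos_symm]
  cNeg_symm i j := by rw [mul_comm (p i : ℝ), G.cNeg_symm]
  cPos_nonneg i j h := by
    have hi := (p i).2.1
    have hj := (p j).2.1
    have hc := G.cPos_nonneg i j h
    positivity
  cNeg_nonneg i j h := by
    have hi := (p i).2.1
    have hj := (p j).2.1
    have hc := G.cNeg_nonneg i j h
    positivity
  eq_zero_or_eq_zero i j h := by
    rcases G.eq_zero_or_eq_zero i j h with h0 | h0 <;> simp [h0]

open Classical in
/-- The probability of the event `E` for the random set `S ⊆ V` that contains every vertex `i`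
independently with probability `p i`: the set `S` has probability
`∏_{i ∈ S} p_i · ∏_{i ∉ S} (1 - p_i)`. -/
def sampleProb {V : Type*} [Fintype V] (p : V → unitInterval) (E : Finset V → Prop) : ℝ :=
  ∑ S : Finset V, if E S then (∏ i ∈ S, (p i : ℝ)) * ∏ i ∈ Sᶜ, (1 - (p i : ℝ)) else 0

/-- The total mass of the sampling law is `1`. -/
theorem sampleProb_true {V : Type*} [Fintype V] (p : V → unitInterval) :
    sampleProb p (fun _ => True) = 1 := by
  classical
  have h := Finset.prod_add (fun i => (p i : ℝ)) (fun i => 1 - (p i : ℝ)) Finset.univ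
  simp only [add_sub_cancel, Finset.prod_const_one, Finset.powerset_univ] at h
  simp only [sampleProb, if_true]
  refine Eq.trans (Finset.sum_congr rfl fun S _ => ?_) h.symm
  rw [← Finset.compl_eq_univ_sdiff]

/-- `x` and `y` are within a factor `c` of each other. -/
def WithinFactor (c x y : ℝ) : Prop :=
  x ≤ c * y ∧ y ≤ c * x

end

/-!
Vertex sampling preserves the maximum cut and the maximum agreement of clusterings.

Both problems maximize, over colorings `y` of the vertices with a palette `κ`, a constant plus the
weight `∑ M i j` of the monochromatic pairs of a signed graph `M`: for cuts `M = -A` and `κ` has two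
elements, and for clusterings `M = c⁺ - c⁻`, where `⌈4 / ε⌉` colors suffice because merging clusters
at random loses an edge between clusters with probability `1 / |κ|` only
(`CorrelationGraph.exists_coloring_agreeScore_ge`). The optimum is at least `n Δ / 4`, so additive
errors of order `ε n Δ` are allowed. Write `X i = 1_{i ∈ S} / p i`.

A fixed clustering is preserved by concentration: its score on the sample is a quadratic form in
`X`, controlled by the linear statistics collected in `ImportanceSampling.Spread`, each of which
obeys a Bernstein inequality (`prob_abs_tail_le`). This gives the lower bound on the optimum of the
sample.

The upper bound has to hold for all colorings of `S` at once, and a union bound over them is too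
expensive. Instead, let `g` be the field of a coloring `y` of the sample,
`g i a = ∑ M i j X j` over the `j` of color `a`. Given a guess `b` of `g`, a minimax argument
(`exists_dual_certificate`) yields a fractional coloring `z` for which
`∑ i, max_a (b i a + (M z) i a) - ⟨z, b⟩` is at most the optimum of the whole graph; the value of `y`
on the sample exceeds the optimum by no more than the error of the guess and the fluctuation of
`∑ X i c i` for the fixed vector `c i = max_a (b i a + (M z) i a)`
(`ImportanceSampling.exists_certificate`). A guess with small `ℓ¹` error is obtained from the colors
of a subsample `T ⊆ S` at the coarser scale `ε² / 30000`: a second moment computation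
(`ImportanceSampling.Balanced.sampleExp_fieldError_sq_le`) shows that at least half of the
subsamples work. Hence the probability that `S` is bad is at most twice the probability that `T`
proposes, for some coloring of `T`, a vector `c` with a large fluctuation. There are only `|κ| ^ |T|`
proposals, and given `T` the remaining vertices are still sampled independently, so a union bound
(`two_stage_union_bound`) wins: the fluctuation has exponent of order `ε² n / (Δ α)`, while the
proposals cost `|κ| n / (Δ ε²)`. This is where `α` of order `ε⁴ / (|κ| log n)` comes from.
-/

noncomputable section

/-! ### Rounding fractional colorings and the dual certificate -/

section Rounding

variable {Q V κ : Type*} [Fintype Q] [Fintype V] [Fintype κ]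

open Classical in
theorem sum_prod_mul_ite_eq {z : Q → κ → ℝ} (hz : ∀ u, ∑ a, z u a = 1) {u v : Q} (huv : u ≠ v) :
    ∑ f : Q → κ, (∏ w, z w (f w)) * (if f u = f v then 1 else 0) = ∑ a, z u a * z v a := by
  have key : ∀ a : κ, ∑ f : Q → κ, (∏ w, z w (f w)) *
      ((if f u = a then 1 else 0) * (if f v = a then 1 else 0)) = z u a * z v a := by
    intro a
    have h1 : ∀ f : Q → κ, (∏ w, z w (f w)) *
        ((if f u = a then 1 else 0) * (if f v = a then 1 else 0)) =
        ∏ w, (z w (f w) * ((if w = u then (if f w = a then 1 else 0) else 1) *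
          (if w = v then (if f w = a then 1 else 0) else 1))) := by
      intro f
      rw [Finset.prod_mul_distrib, Finset.prod_mul_distrib, Finset.prod_ite_eq' Finset.univ u,
        Finset.prod_ite_eq' Finset.univ v]
      simp
    simp_rw [h1]
    have h2 := Finset.prod_univ_sum (fun _ : Q => (Finset.univ : Finset κ))
      (fun w b => z w b * ((if w = u then (if b = a then 1 else 0) else 1) *
          (if w = v then (if b = a then 1 else 0) else 1)))
    rw [Fintype.piFinset_univ] at h2
    rw [← h2]
    have h3 : ∀ w : Q, (∑ b, z w b * ((if w = u then (if b = a then (1:ℝ) else 0) else 1) *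
          (if w = v then (if b = a then 1 else 0) else 1))) =
          (if w = u then z u a else 1) * (if w = v then z v a else 1) := by
      intro w
      by_cases hu : w = u
      · subst hu
        simp [huv]
      · by_cases hv : w = v
        · subst hv
          simp [hu]
        · simp [hu, hv, hz]
    simp_rw [h3]
    rw [Finset.prod_mul_distrib, Finset.prod_ite_eq' Finset.univ u,
        Finset.prod_ite_eq' Finset.univ v]
    simp
  calc _ = ∑ f : Q → κ, ∑ a, (∏ w, z w (f w)) *
      ((if f u = a then 1 else 0) * (if f v = a then 1 else 0)) := by
        refine Finset.sum_congr rfl fun f _ => ?_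
        rw [← Finset.mul_sum]
        congr 1
        simp [eq_comm]
    _ = _ := by
        rw [Finset.sum_comm]
        exact Finset.sum_congr rfl fun a _ => key a

open Classical in
/-- Randomized rounding: color every `u` independently with the distribution `z u`. Some outcome
is at least as good as the expectation. -/
theorem exists_coloring_ge {z : Q → κ → ℝ} (hz0 : ∀ u a, 0 ≤ z u a) (hz : ∀ u, ∑ a, z u a = 1)
    (π : V → Q) {M : V → V → ℝ} (hM : ∀ i j, π i = π j → M i j = 0) :
    ∃ f : Q → κ, ∑ i, ∑ j, M i j * ∑ a, z (π i) a * z (π j) a ≤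
      ∑ i, ∑ j, if f (π i) = f (π j) then M i j else 0 := by
  have hmass : ∑ f : Q → κ, ∏ w, z w (f w) = 1 := by
    have h2 := Finset.prod_univ_sum (fun _ : Q => (Finset.univ : Finset κ)) z
    rw [Fintype.piFinset_univ] at h2
    rw [← h2]
    simp [hz]
  have hE : ∑ f : Q → κ, (∏ w, z w (f w)) *
      (∑ i, ∑ j, if f (π i) = f (π j) then M i j else 0) =
      ∑ i, ∑ j, M i j * ∑ a, z (π i) a * z (π j) a := by
    simp_rw [Finset.mul_sum]
    rw [Finset.sum_comm]
    refine Finset.sum_congr rfl fun i _ => ?_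
    rw [Finset.sum_comm]
    refine Finset.sum_congr rfl fun j _ => ?_
    by_cases hij : π i = π j
    · simp [hM i j hij]
    · rw [← Finset.mul_sum, ← sum_prod_mul_ite_eq hz hij, Finset.mul_sum]
      refine Finset.sum_congr rfl fun f _ => ?_
      split_ifs <;> ring
  by_contra! hcon
  have hw : ∀ f : Q → κ, 0 ≤ ∏ w, z w (f w) := fun f => Finset.prod_nonneg fun w _ => hz0 w _
  have hpos : ∃ f : Q → κ, 0 < ∏ w, z w (f w) := by
    by_contra! h
    have : ∑ f : Q → κ, ∏ w, z w (f w) ≤ 0 := Finset.sum_nonpos fun f _ => h f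
    linarith
  obtain ⟨f₀, hf₀⟩ := hpos
  have hlt : ∑ f : Q → κ, (∏ w, z w (f w)) *
      (∑ i, ∑ j, if f (π i) = f (π j) then M i j else 0) <
      ∑ f : Q → κ, (∏ w, z w (f w)) * ∑ i, ∑ j, M i j * ∑ a, z (π i) a * z (π j) a :=
    Finset.sum_lt_sum (fun f _ => mul_le_mul_of_nonneg_left (hcon f).le (hw f))
      ⟨f₀, Finset.mem_univ _, mul_lt_mul_of_pos_left (hcon f₀) hf₀⟩
  rw [hE, ← Finset.sum_mul, hmass, one_mul] at hlt
  exact lt_irrefl _ hlt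

/-- The polytope of fractional colorings of `V` with palette `κ`. -/
def fractionalColorings (V κ : Type*) [Fintype κ] : Set (V → κ → ℝ) :=
  Set.univ.pi fun _ => stdSimplex ℝ κ

open Classical in
/-- The dual certificate. Let `q` bound the weight `∑ M i j` of the monochromatic pairs of every
coloring. For every guess `b` of the field `M y` of a coloring `y`, some fractional coloring `z`
shows that no coloring beats `q` in the linearized game with payoff
`⟨x, b⟩ + ⟨z, M x - b⟩`. It comes from a saddle point: at `x = z` the payoff is the quadratic form
at `x`, which rounding bounds by `q`. -/
theorem exists_dual_certificate [Nonempty κ] {M : V → V → ℝ}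
    (hdiag : ∀ i, M i i = 0) {q : ℝ}
    (hq : ∀ f : V → κ, ∑ i, ∑ j, (if f i = f j then M i j else 0) ≤ q) (b : V → κ → ℝ) :
    ∃ z ∈ fractionalColorings V κ, ∀ f : V → κ,
      ∑ i, (b i (f i) + ∑ j, M i j * z j (f i)) - ∑ i, ∑ a, z i a * b i a ≤ q := by
  set X := fractionalColorings V κ with hX
  let P : (V → κ → ℝ) → (V → κ → ℝ) → ℝ := fun z x =>
    ∑ i, ∑ a, x i a * (b i a + ∑ j, M i j * z j a) - ∑ i, ∑ a, z i a * b i a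
  have hne : X.Nonempty := by
    refine ⟨fun _ => Pi.single (Classical.arbitrary κ) 1, fun _ _ => single_mem_stdSimplex _ _⟩
  have hconv : Convex ℝ X := convex_pi fun _ _ => convex_stdSimplex ℝ κ
  have hcomp : IsCompact X := isCompact_univ_pi fun _ => isCompact_stdSimplex ℝ κ
  have hPcont : Continuous fun zx : (V → κ → ℝ) × (V → κ → ℝ) => P zx.1 zx.2 := by
    simp only [P]
    fun_prop
  have hlin1 : ∀ x, ∀ z z' : V → κ → ℝ, ∀ s t : ℝ, s + t = 1 →
      P (s • z + t • z') x = s * P z x + t * P z' x := by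
    intro x z z' s t hst
    obtain rfl : t = 1 - s := by linarith
    have e1 : ∀ i a, x i a * (b i a + ∑ j, M i j * (s * z j a + (1 - s) * z' j a)) =
        s * (x i a * (b i a + ∑ j, M i j * z j a)) +
        (1 - s) * (x i a * (b i a + ∑ j, M i j * z' j a)) := by
      intro i a
      have : ∑ j, M i j * (s * z j a + (1 - s) * z' j a) =
          s * ∑ j, M i j * z j a + (1 - s) * ∑ j, M i j * z' j a := by
        rw [Finset.mul_sum, Finset.mul_sum, ← Finset.sum_add_distrib]
        exact Finset.sum_congr rfl fun j _ => by ring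
      rw [this]; ring
    have e2 : ∀ i a, (s * z i a + (1 - s) * z' i a) * b i a =
        s * (z i a * b i a) + (1 - s) * (z' i a * b i a) := fun i a => by ring
    simp only [P, Pi.add_apply, Pi.smul_apply, smul_eq_mul, e1, e2, Finset.sum_add_distrib,
      ← Finset.mul_sum]
    ring
  have hlin2 : ∀ z, ∀ x x' : V → κ → ℝ, ∀ s t : ℝ, s + t = 1 →
      P z (s • x + t • x') = s * P z x + t * P z x' := by
    intro z x x' s t hst
    obtain rfl : t = 1 - s := by linarith
    simp only [P, Pi.add_apply, Pi.smul_apply, smul_eq_mul, add_mul, Finset.sum_add_distrib,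
      mul_assoc, ← Finset.mul_sum]
    ring
  have hsaddle : ∃ z ∈ X, ∃ x ∈ X, IsSaddlePointOn X X P z x := by
    refine Sion.exists_isSaddlePointOn hne hconv hcomp ?_ ?_ hconv hne hcomp ?_ ?_
    · intro x _
      exact (hPcont.comp (Continuous.prodMk continuous_id
        continuous_const)).lowerSemicontinuous.lowerSemicontinuousOn _
    · intro x _
      refine ConvexOn.quasiconvexOn ⟨hconv, fun z _ z' _ s t _ _ hst => ?_⟩
      exact (hlin1 x z z' s t hst).le
    · intro z _
      exact (hPcont.comp (Continuous.prodMk continuous_const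
        continuous_id)).upperSemicontinuous.upperSemicontinuousOn _
    · intro z _
      refine ConcaveOn.quasiconcaveOn ⟨hconv, fun x _ x' _ s t _ _ hst => ?_⟩
      exact (hlin2 z x x' s t hst).ge
  obtain ⟨z, hz, x, hx, hzx⟩ := hsaddle
  refine ⟨z, hz, fun f => ?_⟩
  have h1 := hzx x hx (fun i => Pi.single (f i) 1) (fun i _ => single_mem_stdSimplex _ _)
  have h2 : P z (fun i => Pi.single (f i) 1) =
      ∑ i, (b i (f i) + ∑ j, M i j * z j (f i)) - ∑ i, ∑ a, z i a * b i a := by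
    simp only [P]
    congr 1
    refine Finset.sum_congr rfl fun i _ => ?_
    simp [Pi.single_apply]
  have h3 : P x x = ∑ i, ∑ j, M i j * ∑ a, x i a * x j a := by
    simp only [P, mul_add, Finset.sum_add_distrib, add_sub_cancel_left]
    refine Finset.sum_congr rfl fun i _ => ?_
    simp_rw [Finset.mul_sum]
    rw [Finset.sum_comm]
    exact Finset.sum_congr rfl fun j _ => Finset.sum_congr rfl fun a _ => by ring
  obtain ⟨g, hg⟩ := exists_coloring_ge (Q := V) (fun u a => (hx u trivial).1 a)
    (fun u => (hx u trivial).2) id (M := M) (fun i j h => by obtain rfl : i = j := h; exact hdiag i)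
  simp only [id] at hg
  calc _ = P z (fun i => Pi.single (f i) 1) := h2.symm
    _ ≤ P x x := h1
    _ ≤ _ := h3 ▸ hg
    _ ≤ q := hq g

end Rounding

/-! ### Independent vertex sampling -/

section Sampling

variable {V : Type*}

/-- The normalized indicator `1_{i ∈ S} / p_i`, of expectation `1`. -/
def invIndicator (p : V → ℝ) (S : Finset V) (i : V) : ℝ :=
  Set.indicator (S : Set V) (fun j => (p j)⁻¹) i

open Classical in
theorem invIndicator_eq (p : V → ℝ) (S : Finset V) (i : V) :
    invIndicator p S i = if i ∈ S then (p i)⁻¹ else 0 := by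
  simp [invIndicator, Set.indicator_apply]

theorem invIndicator_nonneg {p : V → ℝ} (hp : ∀ i, 0 ≤ p i) (S : Finset V) (i : V) :
    0 ≤ invIndicator p S i := by
  classical
  rw [invIndicator_eq]
  split_ifs
  · exact inv_nonneg.2 (hp i)
  · exact le_rfl

variable [Fintype V]

open Classical in
/-- The probability that vertex sampling with inclusion probabilities `p` returns `S`. -/
def sampleWeight (p : V → ℝ) (S : Finset V) : ℝ :=
  ∏ i, if i ∈ S then p i else 1 - p i

/-- The expectation of `F S` for the random set `S` that contains every `i` independently with
probability `p i`. -/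
def sampleExp (p : V → ℝ) (F : Finset V → ℝ) : ℝ :=
  ∑ S : Finset V, sampleWeight p S * F S

theorem sampleWeight_nonneg {p : V → ℝ} (hp0 : ∀ i, 0 ≤ p i) (hp1 : ∀ i, p i ≤ 1)
    (S : Finset V) : 0 ≤ sampleWeight p S := by
  refine Finset.prod_nonneg fun i _ => ?_
  split_ifs
  · exact hp0 i
  · exact sub_nonneg.2 (hp1 i)

open Classical in
theorem sampleExp_prod (p f g : V → ℝ) :
    sampleExp p (fun S => ∏ i, if i ∈ S then f i else g i) =
      ∏ i, (p i * f i + (1 - p i) * g i) := by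
  rw [Finset.prod_add, Finset.powerset_univ]
  refine Finset.sum_congr rfl fun S _ => ?_
  rw [sampleWeight, ← Finset.prod_mul_distrib, ← Finset.prod_mul_prod_compl S,
    Finset.compl_eq_univ_sdiff]
  congr 1
  · exact Finset.prod_congr rfl fun i hi => by simp [hi]
  · exact Finset.prod_congr rfl fun i hi => by
      have : i ∉ S := (Finset.mem_sdiff.1 hi).2
      simp [this]

theorem sampleExp_mono {p : V → ℝ} (hp0 : ∀ i, 0 ≤ p i) (hp1 : ∀ i, p i ≤ 1)
    {F G : Finset V → ℝ} (h : ∀ S, F S ≤ G S) : sampleExp p F ≤ sampleExp p G :=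
  Finset.sum_le_sum fun S _ => mul_le_mul_of_nonneg_left (h S) (sampleWeight_nonneg hp0 hp1 S)

theorem sampleExp_const (p : V → ℝ) (c : ℝ) : sampleExp p (fun _ => c) = c := by
  classical
  have h := sampleExp_prod p (fun _ => 1) (fun _ => 1)
  simp only [ite_self, Finset.prod_const_one, mul_one, add_sub_cancel] at h
  simp only [sampleExp, mul_one] at h ⊢
  rw [← Finset.sum_mul, h, one_mul]

theorem sampleExp_add (p : V → ℝ) (F G : Finset V → ℝ) :
    sampleExp p (fun S => F S + G S) = sampleExp p F + sampleExp p G := by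
  simp [sampleExp, mul_add, Finset.sum_add_distrib]

theorem sampleExp_mul_left (p : V → ℝ) (c : ℝ) (F : Finset V → ℝ) :
    sampleExp p (fun S => c * F S) = c * sampleExp p F := by
  simp only [sampleExp, Finset.mul_sum]
  exact Finset.sum_congr rfl fun S _ => by ring

theorem sampleExp_sum {ι : Type*} (s : Finset ι) (p : V → ℝ) (F : ι → Finset V → ℝ) :
    sampleExp p (fun S => ∑ k ∈ s, F k S) = ∑ k ∈ s, sampleExp p (F k) := by
  simp only [sampleExp, Finset.mul_sum]
  exact Finset.sum_comm

theorem sampleExp_nonneg {p : V → ℝ} (hp0 : ∀ i, 0 ≤ p i) (hp1 : ∀ i, p i ≤ 1)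
    {F : Finset V → ℝ} (h : ∀ S, 0 ≤ F S) : 0 ≤ sampleExp p F :=
  Finset.sum_nonneg fun S _ => mul_nonneg (sampleWeight_nonneg hp0 hp1 S) (h S)

open Classical in
/-- The probability of `E S` for the random set `S` with inclusion probabilities `p`. -/
def prob (p : V → ℝ) (E : Finset V → Prop) : ℝ :=
  sampleExp p fun S => if E S then 1 else 0

theorem prob_mono {p : V → ℝ} (hp0 : ∀ i, 0 ≤ p i) (hp1 : ∀ i, p i ≤ 1)
    {E F : Finset V → Prop} (h : ∀ S, E S → F S) : prob p E ≤ prob p F :=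
  sampleExp_mono hp0 hp1 fun S => by
    by_cases hE : E S
    · simp [hE, h S hE]
    · simp only [hE, if_false]; split_ifs <;> norm_num

theorem prob_or_le {p : V → ℝ} (hp0 : ∀ i, 0 ≤ p i) (hp1 : ∀ i, p i ≤ 1)
    (E F : Finset V → Prop) : prob p (fun S => E S ∨ F S) ≤ prob p E + prob p F := by
  rw [prob, prob, prob, ← sampleExp_add]
  refine sampleExp_mono hp0 hp1 fun S => ?_
  by_cases hE : E S <;> by_cases hF : F S <;> simp [hE, hF]

theorem prob_exists_le {p : V → ℝ} (hp0 : ∀ i, 0 ≤ p i) (hp1 : ∀ i, p i ≤ 1)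
    {ι : Type*} [Fintype ι] (E : ι → Finset V → Prop) :
    prob p (fun S => ∃ k, E k S) ≤ ∑ k, prob p (E k) := by
  classical
  simp only [prob]
  rw [← sampleExp_sum]
  refine sampleExp_mono hp0 hp1 fun S => ?_
  split_ifs with h
  · obtain ⟨k, hk⟩ := h
    calc (1 : ℝ) = if E k S then 1 else 0 := by simp [hk]
      _ ≤ _ := Finset.single_le_sum (f := fun k => if E k S then (1 : ℝ) else 0)
        (fun l _ => by split_ifs <;> norm_num) (Finset.mem_univ k)
  · exact Finset.sum_nonneg fun l _ => by split_ifs <;> norm_num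

theorem prob_add_prob_not (p : V → ℝ) (E : Finset V → Prop) :
    prob p E + prob p (fun S => ¬ E S) = 1 := by
  rw [prob, prob, ← sampleExp_add]
  refine Eq.trans ?_ (sampleExp_const p 1)
  congr 1
  ext S
  by_cases h : E S <;> simp [h]

theorem prob_le_exp {p : V → ℝ} (hp0 : ∀ i, 0 ≤ p i) (hp1 : ∀ i, p i ≤ 1)
    (F : Finset V → ℝ) : prob p (fun S => 0 ≤ F S) ≤ sampleExp p fun S => Real.exp (F S) := by
  refine sampleExp_mono hp0 hp1 fun S => ?_
  split_ifs with h
  · exact Real.one_le_exp h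
  · exact (Real.exp_pos _).le

theorem prob_le_div {p : V → ℝ} (hp0 : ∀ i, 0 ≤ p i) (hp1 : ∀ i, p i ≤ 1)
    {F : Finset V → ℝ} (hF : ∀ S, 0 ≤ F S) {t : ℝ} (ht : 0 < t) :
    prob p (fun S => t ≤ F S) ≤ sampleExp p F / t := by
  rw [div_eq_inv_mul, ← sampleExp_mul_left]
  refine sampleExp_mono hp0 hp1 fun S => ?_
  split_ifs with h
  · rw [← div_eq_inv_mul]; exact (one_le_div ht).2 h
  · exact mul_nonneg (inv_nonneg.2 ht.le) (hF S)

open Classical in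
theorem sampleProb_eq_prob (p : V → unitInterval) (E : Finset V → Prop) :
    sampleProb p E = prob (fun i => (p i : ℝ)) E := by
  refine Finset.sum_congr rfl fun S _ => ?_
  have : sampleWeight (fun i => (p i : ℝ)) S =
      (∏ i ∈ S, (p i : ℝ)) * ∏ i ∈ Sᶜ, (1 - (p i : ℝ)) := by
    rw [sampleWeight, ← Finset.prod_mul_prod_compl S]
    congr 1
    · exact Finset.prod_congr rfl fun i hi => by simp [hi]
    · exact Finset.prod_congr rfl fun i hi => by simp [Finset.mem_compl.1 hi]
  rw [this]
  by_cases h : E S <;> simp [h]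

/-! ### Concentration of linear statistics -/

theorem exp_le_one_add_add_sq {v : ℝ} (hv : |v| ≤ 1) : Real.exp v ≤ 1 + v + v ^ 2 := by
  have := (abs_le.1 (Real.abs_exp_sub_one_sub_id_le hv)).2
  linarith

open Classical in
theorem exp_sum_invIndicator (p u : V → ℝ) (S : Finset V) :
    Real.exp (∑ i, (invIndicator p S i - 1) * u i) =
      ∏ i, if i ∈ S then Real.exp (((p i)⁻¹ - 1) * u i) else Real.exp (-u i) := by
  rw [Real.exp_sum]
  refine Finset.prod_congr rfl fun i _ => ?_
  rw [invIndicator_eq]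
  split_ifs <;> simp

/-- The exponential moment of one centered normalized indicator. -/
theorem bernoulli_mgf_le {p u : ℝ} (hp0 : 0 < p) (hu : |u| ≤ p) :
    p * Real.exp ((p⁻¹ - 1) * u) + (1 - p) * Real.exp (-u) ≤ Real.exp (u ^ 2 / p) := by
  have h1 : Real.exp ((p⁻¹ - 1) * u) = Real.exp (-u) * Real.exp (u / p) := by
    rw [← Real.exp_add]; congr 1; field_simp; ring
  have h2 : |u / p| ≤ 1 := by
    rw [abs_div, abs_of_pos hp0]; exact (div_le_one hp0).2 hu
  have h3 := exp_le_one_add_add_sq h2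
  have h4 : p * Real.exp ((p⁻¹ - 1) * u) + (1 - p) * Real.exp (-u) ≤
      Real.exp (-u) * (1 + (u + u ^ 2 / p)) := by
    rw [h1]
    have : p * Real.exp (u / p) + (1 - p) ≤ 1 + (u + u ^ 2 / p) := by
      calc _ ≤ p * (1 + u / p + (u / p) ^ 2) + (1 - p) := by gcongr
        _ = _ := by field_simp; ring
    nlinarith [Real.exp_pos (-u)]
  calc _ ≤ Real.exp (-u) * (1 + (u + u ^ 2 / p)) := h4
    _ ≤ Real.exp (-u) * Real.exp (u + u ^ 2 / p) := by
        gcongr; linarith [Real.add_one_le_exp (u + u ^ 2 / p)]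
    _ = _ := by rw [← Real.exp_add]; congr 1; ring

/-- A Bernstein inequality. Coordinates with `p i = 1` are deterministic, so no bound on `f i` is
needed there. -/
theorem prob_upper_tail_le {p : V → ℝ} (hp0 : ∀ i, 0 < p i) (hp1 : ∀ i, p i ≤ 1)
    {f : V → ℝ} {R L lam t : ℝ} (hf : ∀ i, p i = 1 ∨ |f i| ≤ R * p i) (hR : 0 ≤ R)
    (hL : ∑ i, |f i| ≤ L) (hlam : 0 ≤ lam) (hlamR : lam * R ≤ 1) :
    prob p (fun S => t ≤ ∑ i, (invIndicator p S i - 1) * f i) ≤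
      Real.exp (lam ^ 2 * R * L - lam * t) := by
  classical
  have hp0' := fun i => (hp0 i).le
  rcases hlam.eq_or_lt with rfl | hlam'
  · have : prob p (fun S => t ≤ ∑ i, (invIndicator p S i - 1) * f i) ≤ 1 := by
      have := prob_mono hp0' hp1 (E := fun S => t ≤ ∑ i, (invIndicator p S i - 1) * f i)
        (F := fun _ => True) (fun _ _ => trivial)
      simpa [prob, sampleExp_const] using this
    simpa using this
  have h1 : prob p (fun S => t ≤ ∑ i, (invIndicator p S i - 1) * f i) ≤
      prob p (fun S => 0 ≤ ∑ i, (invIndicator p S i - 1) * (lam * f i) + -(lam * t)) := by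
    refine prob_mono hp0' hp1 fun S hS => ?_
    have : ∑ i, (invIndicator p S i - 1) * (lam * f i) =
        lam * ∑ i, (invIndicator p S i - 1) * f i := by
      rw [Finset.mul_sum]; exact Finset.sum_congr rfl fun i _ => by ring
    rw [this]
    nlinarith
  refine h1.trans ((prob_le_exp hp0' hp1 _).trans ?_)
  simp_rw [Real.exp_add, exp_sum_invIndicator, mul_comm _ (Real.exp (-(lam * t)))]
  rw [sampleExp_mul_left, sampleExp_prod, sub_eq_add_neg, Real.exp_add,
    mul_comm (Real.exp (lam ^ 2 * R * L))]
  gcongr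
  have h2 : ∀ i, p i * Real.exp (((p i)⁻¹ - 1) * (lam * f i)) +
      (1 - p i) * Real.exp (-(lam * f i)) ≤ Real.exp (lam ^ 2 * R * |f i|) := by
    intro i
    rcases hf i with h | h
    · simp only [h, inv_one, sub_self, zero_mul, Real.exp_zero, mul_one, add_zero]
      exact Real.one_le_exp (by positivity)
    · refine (bernoulli_mgf_le (hp0 i) ?_).trans (Real.exp_le_exp.2 ?_)
      · rw [abs_mul, abs_of_pos hlam']
        nlinarith [hp0 i]
      · rw [div_le_iff₀ (hp0 i), mul_pow, ← sq_abs (f i)]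
        nlinarith [mul_le_mul_of_nonneg_left h (mul_nonneg (sq_nonneg lam) (abs_nonneg (f i)))]
  calc _ ≤ ∏ i, Real.exp (lam ^ 2 * R * |f i|) :=
        Finset.prod_le_prod (fun i _ => add_nonneg (mul_nonneg (hp0' i) (Real.exp_pos _).le)
          (mul_nonneg (sub_nonneg.2 (hp1 i)) (Real.exp_pos _).le)) fun i _ => h2 i
    _ = Real.exp (lam ^ 2 * R * ∑ i, |f i|) := by rw [← Real.exp_sum, Finset.mul_sum]
    _ ≤ _ := by gcongr

theorem prob_abs_tail_le {p : V → ℝ} (hp0 : ∀ i, 0 < p i) (hp1 : ∀ i, p i ≤ 1)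
    {f : V → ℝ} {R L lam t : ℝ} (hf : ∀ i, p i = 1 ∨ |f i| ≤ R * p i) (hR : 0 ≤ R)
    (hL : ∑ i, |f i| ≤ L) (hlam : 0 ≤ lam) (hlamR : lam * R ≤ 1) :
    prob p (fun S => t ≤ |∑ i, (invIndicator p S i - 1) * f i|) ≤
      2 * Real.exp (lam ^ 2 * R * L - lam * t) := by
  have hp0' := fun i => (hp0 i).le
  have h1 := prob_upper_tail_le hp0 hp1 (t := t) hf hR hL hlam hlamR
  have h2 := prob_upper_tail_le hp0 hp1 (f := fun i => -f i) (t := t) (by simpa using hf) hR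
    (by simpa using hL) hlam hlamR
  have h3 : prob p (fun S => t ≤ |∑ i, (invIndicator p S i - 1) * f i|) ≤
      prob p (fun S => t ≤ ∑ i, (invIndicator p S i - 1) * f i ∨
        t ≤ ∑ i, (invIndicator p S i - 1) * -f i) := by
    refine prob_mono hp0' hp1 fun S hS => ?_
    simp only [mul_neg, Finset.sum_neg_distrib]
    exact le_abs.1 hS
  have h4 := prob_or_le hp0' hp1 (fun S => t ≤ ∑ i, (invIndicator p S i - 1) * f i)
    (fun S => t ≤ ∑ i, (invIndicator p S i - 1) * -f i)
  linarith

open Classical in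
theorem sampleExp_sub_one_mul_sub_one {q : V → ℝ} (hq0 : ∀ i, 0 < q i) (j l : V) :
    sampleExp q (fun W => (invIndicator q W j - 1) * (invIndicator q W l - 1)) =
      if j = l then (q j)⁻¹ - 1 else 0 := by
  have h : ∀ W : Finset V, (invIndicator q W j - 1) * (invIndicator q W l - 1) =
      ∏ i, if i ∈ W then
        (if i = j then (q i)⁻¹ - 1 else 1) * (if i = l then (q i)⁻¹ - 1 else 1)
      else (if i = j then -1 else 1) * (if i = l then -1 else 1) := by
    intro W
    have : ∀ i, (if i ∈ W then
        (if i = j then (q i)⁻¹ - 1 else 1) * (if i = l then (q i)⁻¹ - 1 else 1)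
      else (if i = j then -1 else 1) * (if i = l then -1 else 1)) =
      (if i = j then invIndicator q W i - 1 else 1) *
        (if i = l then invIndicator q W i - 1 else 1) := by
      intro i
      rw [invIndicator_eq]
      by_cases hW : i ∈ W <;> simp [hW]
    simp_rw [this]
    rw [Finset.prod_mul_distrib, Finset.prod_ite_eq', Finset.prod_ite_eq']
    simp
  simp_rw [h]
  rw [sampleExp_prod]
  have hj := (hq0 j).ne'
  split_ifs with hjl
  · subst hjl
    rw [Finset.prod_eq_single j]
    · simp only [if_true]; field_simp; ring
    · intro i _ hij; simp [hij]
    · simp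
  · refine Finset.prod_eq_zero (Finset.mem_univ j) ?_
    simp only [if_true, if_neg hjl]
    field_simp; ring

/-- The variance of a linear statistic of independent indicators. -/
theorem sampleExp_sq_sum {q : V → ℝ} (hq0 : ∀ i, 0 < q i) (a : V → ℝ) :
    sampleExp q (fun W => (∑ j, a j * (invIndicator q W j - 1)) ^ 2) =
      ∑ j, a j ^ 2 * ((q j)⁻¹ - 1) := by
  classical
  have h : ∀ W, (∑ j, a j * (invIndicator q W j - 1)) ^ 2 =
      ∑ j, ∑ l, a j * a l * ((invIndicator q W j - 1) * (invIndicator q W l - 1)) := by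
    intro W
    rw [sq, Finset.sum_mul_sum]
    exact Finset.sum_congr rfl fun j _ => Finset.sum_congr rfl fun l _ => by ring
  simp_rw [h]
  rw [sampleExp_sum]
  refine Finset.sum_congr rfl fun j _ => ?_
  rw [sampleExp_sum]
  simp_rw [sampleExp_mul_left, sampleExp_sub_one_mul_sub_one hq0]
  simp [sq]

end Sampling

/-! ### The two-stage union bound -/

section TwoStage

variable {V : Type*} [Fintype V]

open Classical in
/-- Two-stage sampling: a product statistic of `S` and of a subsample `W` of inclusion
probabilities `q` factors over the vertices. -/
theorem sampleExp_sampleExp_prod (p q : V → ℝ) (F : V → Prop → Prop → ℝ) :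
    sampleExp p (fun S => sampleExp q fun W => ∏ i, F i (i ∈ S) (i ∈ W)) =
      ∏ i, (p i * (q i * F i True True + (1 - q i) * F i True False) +
        (1 - p i) * (q i * F i False True + (1 - q i) * F i False False)) := by
  rw [← sampleExp_prod]
  congr 1
  ext S
  have h1 : ∀ W : Finset V, ∏ i, F i (i ∈ S) (i ∈ W) =
      ∏ i, if i ∈ W then F i (i ∈ S) True else F i (i ∈ S) False := by
    intro W
    refine Finset.prod_congr rfl fun i _ => ?_
    by_cases h : i ∈ W <;> simp [h]
  simp_rw [h1]
  rw [sampleExp_prod]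
  refine Finset.prod_congr rfl fun i _ => ?_
  by_cases h : i ∈ S <;> simp [h]

/-- The vertex factor of the joint exponential moment: conditioned on the subsample, a vertex that
it misses is still sampled with probability `(p - p q) / (1 - p q) ≤ p`. -/
theorem two_stage_factor_le {p q a s : ℝ} (hp0 : 0 < p) (hp1 : p ≤ 1) (hq0 : 0 ≤ q) (hq1 : q ≤ 1)
    (ha : 0 ≤ a) (hs : 0 ≤ s) (hpa : p = 1 ∨ (a ≤ p ∧ a ^ 2 ≤ s * p)) (inT : Prop) [Decidable inT] :
    p * (q * (if inT then Real.exp ((p⁻¹ - 1) * a) else 0) +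
        (1 - q) * (if inT then 0 else Real.exp ((p⁻¹ - 1) * a))) +
      (1 - p) * (if inT then 0 else Real.exp (-a)) ≤
    (if inT then Real.exp 1 * (p * q) else 1 - p * q) * Real.exp s := by
  have hpq : p * q ≤ 1 := mul_le_one₀ hp1 hq0 hq1
  have hs1 : 1 ≤ Real.exp s := Real.one_le_exp hs
  have hpinv : 1 ≤ p⁻¹ := (one_le_inv₀ hp0).2 hp1
  split_ifs with h
  · have h1 : (p⁻¹ - 1) * a ≤ 1 := by
      rcases hpa with rfl | ⟨h1, -⟩
      · simp
      · calc (p⁻¹ - 1) * a ≤ p⁻¹ * p := by gcongr; linarith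
          _ = 1 := inv_mul_cancel₀ hp0.ne'
    have h2 := Real.exp_le_exp.2 h1
    calc _ = p * q * Real.exp ((p⁻¹ - 1) * a) := by ring
      _ ≤ p * q * (Real.exp 1 * Real.exp s) := by
          gcongr
          nlinarith [Real.exp_pos 1]
      _ = _ := by ring
  · rcases hpa with rfl | ⟨h1, h2⟩
    · simp only [inv_one, sub_self, zero_mul, Real.exp_zero, one_mul, mul_zero, zero_add, mul_one,
        add_zero]
      nlinarith
    · have e1 : Real.exp ((p⁻¹ - 1) * a) = Real.exp (-a) * Real.exp (a / p) := by
        rw [← Real.exp_add]; congr 1; field_simp; ring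
      have h3 := exp_le_one_add_add_sq (v := a / p) (by
        rw [abs_of_nonneg (by positivity)]; exact (div_le_one hp0).2 h1)
      have hb : 0 ≤ a / p + (a / p) ^ 2 := by positivity
      have h4 : p * (1 - q) * Real.exp (a / p) + (1 - p) ≤ (1 - p * q) * (1 + (a + s)) := by
        have h5 : p * (a / p + (a / p) ^ 2) ≤ a + s := by
          have : p * (a / p + (a / p) ^ 2) = a + a ^ 2 / p := by field_simp
          rw [this]
          have := (div_le_iff₀ hp0).2 h2
          linarith
        calc _ ≤ p * (1 - q) * (1 + a / p + (a / p) ^ 2) + (1 - p) := by gcongr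
          _ = (1 - p * q) + p * (1 - q) * (a / p + (a / p) ^ 2) := by ring
          _ ≤ (1 - p * q) + p * (1 - p * q) * (a / p + (a / p) ^ 2) := by
              have : 1 - q ≤ 1 - p * q := by nlinarith
              gcongr
          _ = (1 - p * q) * (1 + p * (a / p + (a / p) ^ 2)) := by ring
          _ ≤ _ := by
              apply mul_le_mul_of_nonneg_left _ (by linarith)
              linarith
      calc _ = Real.exp (-a) * (p * (1 - q) * Real.exp (a / p) + (1 - p)) := by rw [e1]; ring
        _ ≤ Real.exp (-a) * ((1 - p * q) * (1 + (a + s))) := by gcongr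
        _ ≤ Real.exp (-a) * ((1 - p * q) * Real.exp (a + s)) := by
            have := Real.add_one_le_exp (a + s)
            gcongr
            linarith
        _ = _ := by
            rw [mul_left_comm, ← Real.exp_add]
            congr 2; ring

open Classical in
/-- A union bound over statistics that depend on a subsample. The subsample `T = S ∩ W` proposes a
family `𝓒 T` of at most `K ^ |T|` nonnegative vectors `c`, and the sum of `c i / p i` over `S`
rarely exceeds `∑ c i` by `t` for any of them. Since `S` is still a product sample conditionally on `T`, each `c` obeys a
Bernstein bound, and the expected size of the family costs only `exp (K e ∑ p i q i)`. -/
theorem two_stage_union_bound {p q : V → ℝ} (hp0 : ∀ i, 0 < p i) (hp1 : ∀ i, p i ≤ 1)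
    (hq0 : ∀ i, 0 ≤ q i) (hq1 : ∀ i, q i ≤ 1) {𝓒 : Finset V → Finset (V → ℝ)} {K R L lam t : ℝ}
    (hK : 0 ≤ K) (hcard : ∀ T, ((𝓒 T).card : ℝ) ≤ K ^ T.card)
    (hc0 : ∀ T, ∀ c ∈ 𝓒 T, ∀ i, 0 ≤ c i)
    (hcR : ∀ T, ∀ c ∈ 𝓒 T, ∀ i, p i = 1 ∨ c i ≤ R * p i)
    (hcL : ∀ T, ∀ c ∈ 𝓒 T, ∑ i, c i ≤ L) (hR : 0 ≤ R) (hlam : 0 < lam) (hlamR : lam * R ≤ 1) :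
    sampleExp p (fun S => prob q fun W =>
      ∃ c ∈ 𝓒 (S ∩ W), t ≤ ∑ i, (invIndicator p S i - 1) * c i) ≤
      Real.exp (lam ^ 2 * R * L - lam * t + K * Real.exp 1 * ∑ i, p i * q i) := by
  have hp0' := fun i => (hp0 i).le
  -- the vertex factors of `1_{S ∩ W = T} exp (lam ∑ (X i - 1) c i)`
  let F : Finset V → (V → ℝ) → V → Prop → Prop → ℝ := fun T c i s w =>
    if ((s ∧ w) ↔ i ∈ T) then
      (if s then Real.exp (((p i)⁻¹ - 1) * (lam * c i)) else Real.exp (-(lam * c i))) else 0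
  have hF : ∀ T c (S W : Finset V), ∏ i, F T c i (i ∈ S) (i ∈ W) =
      if S ∩ W = T then Real.exp (lam * ∑ i, (invIndicator p S i - 1) * c i) else 0 := by
    intro T c S W
    split_ifs with h
    · have e : lam * ∑ i, (invIndicator p S i - 1) * c i =
          ∑ i, (invIndicator p S i - 1) * (lam * c i) := by
        rw [Finset.mul_sum]; exact Finset.sum_congr rfl fun i _ => by ring
      rw [e, exp_sum_invIndicator]
      refine Finset.prod_congr rfl fun i _ => ?_
      have : (i ∈ S ∧ i ∈ W) ↔ i ∈ T := by rw [← h, Finset.mem_inter]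
      simp only [F, if_pos this]
      by_cases hi : i ∈ S <;> simp [hi]
    · have : ∃ i, ¬ ((i ∈ S ∧ i ∈ W) ↔ i ∈ T) := by
        by_contra! hcon
        exact h (Finset.ext fun i => by rw [Finset.mem_inter]; exact hcon i)
      obtain ⟨i, hi⟩ := this
      exact Finset.prod_eq_zero (Finset.mem_univ i) (by simp only [F, if_neg hi])
  have hpt : ∀ S W : Finset V,
      (if ∃ c ∈ 𝓒 (S ∩ W), t ≤ ∑ i, (invIndicator p S i - 1) * c i then (1 : ℝ) else 0) ≤
      ∑ T, ∑ c ∈ 𝓒 T, Real.exp (-(lam * t)) * ∏ i, F T c i (i ∈ S) (i ∈ W) := by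
    intro S W
    have hnn : ∀ T c, 0 ≤ Real.exp (-(lam * t)) * ∏ i, F T c i (i ∈ S) (i ∈ W) := by
      intro T c
      rw [hF]; split_ifs <;> positivity
    split_ifs with h
    · obtain ⟨c, hc, hct⟩ := h
      calc (1 : ℝ) ≤ Real.exp (-(lam * t)) * ∏ i, F (S ∩ W) c i (i ∈ S) (i ∈ W) := by
            rw [hF, if_pos rfl, ← Real.exp_add]
            exact Real.one_le_exp (by nlinarith)
        _ ≤ ∑ c ∈ 𝓒 (S ∩ W),
              Real.exp (-(lam * t)) * ∏ i, F (S ∩ W) c i (i ∈ S) (i ∈ W) :=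
            Finset.single_le_sum
              (f := fun c => Real.exp (-(lam * t)) * ∏ i, F (S ∩ W) c i (i ∈ S) (i ∈ W))
              (fun c _ => hnn _ c) hc
        _ ≤ _ := Finset.single_le_sum
              (f := fun T => ∑ c ∈ 𝓒 T, Real.exp (-(lam * t)) * ∏ i, F T c i (i ∈ S) (i ∈ W))
              (fun T _ => Finset.sum_nonneg fun c _ => hnn T c) (Finset.mem_univ _)
    · exact Finset.sum_nonneg fun T _ => Finset.sum_nonneg fun c _ => hnn T c
  have hfac : ∀ T, ∀ c ∈ 𝓒 T,
      sampleExp p (fun S => sampleExp q fun W => ∏ i, F T c i (i ∈ S) (i ∈ W)) ≤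
      Real.exp (lam ^ 2 * R * L) *
        ∏ i, (if i ∈ T then Real.exp 1 * (p i * q i) else 1 - p i * q i) := by
    intro T c hc
    rw [sampleExp_sampleExp_prod]
    have hle : ∀ i, p i * (q i * F T c i True True + (1 - q i) * F T c i True False) +
        (1 - p i) * (q i * F T c i False True + (1 - q i) * F T c i False False) ≤
        (if i ∈ T then Real.exp 1 * (p i * q i) else 1 - p i * q i) *
          Real.exp (lam ^ 2 * R * c i) := by
      intro i
      have hci := hc0 T c hc i
      refine le_trans (le_of_eq ?_) (two_stage_factor_le (a := lam * c i) (hp0 i) (hp1 i) (hq0 i)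
        (hq1 i) (by positivity) (by positivity) ?_ (i ∈ T))
      · by_cases hi : i ∈ T
        · simp [F, hi]
        · simp only [F, hi]; simp; left; ring
      · rcases hcR T c hc i with h | h
        · exact Or.inl h
        · refine Or.inr ⟨by nlinarith [hp0 i], ?_⟩
          nlinarith [mul_le_mul_of_nonneg_left h (mul_nonneg (sq_nonneg lam) hci)]
    have hnn : ∀ i, 0 ≤ p i * (q i * F T c i True True + (1 - q i) * F T c i True False) +
        (1 - p i) * (q i * F T c i False True + (1 - q i) * F T c i False False) := by
      intro i
      have hF0 : ∀ s w, 0 ≤ F T c i s w := by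
        intro s w; simp only [F]; split_ifs <;> positivity
      have := hq0 i; have := hp0' i
      have h1 := sub_nonneg.2 (hq1 i); have h2 := sub_nonneg.2 (hp1 i)
      have := hF0 True True; have := hF0 True False
      have := hF0 False True; have := hF0 False False
      positivity
    refine (Finset.prod_le_prod (fun i _ => hnn i) fun i _ => hle i).trans ?_
    rw [Finset.prod_mul_distrib, mul_comm, ← Real.exp_sum, ← Finset.mul_sum]
    have h2 : 0 ≤ ∏ i, (if i ∈ T then Real.exp 1 * (p i * q i) else 1 - p i * q i) := by
      refine Finset.prod_nonneg fun i _ => ?_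
      split_ifs
      · have := hq0 i; have := hp0' i; positivity
      · exact sub_nonneg.2 (mul_le_one₀ (hp1 i) (hq0 i) (hq1 i))
    refine mul_le_mul_of_nonneg_right (Real.exp_le_exp.2 ?_) h2
    exact mul_le_mul_of_nonneg_left (hcL T c hc) (by positivity)
  have hsumT : ∑ T : Finset V, K ^ T.card *
      ∏ i, (if i ∈ T then Real.exp 1 * (p i * q i) else 1 - p i * q i) ≤
      Real.exp (K * Real.exp 1 * ∑ i, p i * q i) := by
    have h1 : ∀ T : Finset V, K ^ T.card *
        ∏ i, (if i ∈ T then Real.exp 1 * (p i * q i) else 1 - p i * q i) =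
        sampleWeight (fun i => p i * q i) T *
          ∏ i, (if i ∈ T then K * Real.exp 1 else (1 : ℝ)) := by
      intro T
      have : K ^ T.card = ∏ i, (if i ∈ T then K else (1 : ℝ)) := by
        rw [Finset.prod_ite]; simp
      rw [this, sampleWeight, ← Finset.prod_mul_distrib, ← Finset.prod_mul_distrib]
      refine Finset.prod_congr rfl fun i _ => ?_
      split_ifs <;> ring
    simp_rw [h1]
    have h2 := sampleExp_prod (fun i => p i * q i) (fun _ => K * Real.exp 1) (fun _ => (1 : ℝ))
    rw [sampleExp] at h2
    rw [h2, Finset.mul_sum, Real.exp_sum]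
    refine Finset.prod_le_prod (fun i _ => ?_) fun i _ => ?_
    · have h3 := sub_nonneg.2 (mul_le_one₀ (hp1 i) (hq0 i) (hq1 i))
      have := hq0 i; have := hp0' i
      positivity
    · have := Real.add_one_le_exp (K * Real.exp 1 * (p i * q i))
      have := mul_nonneg (hp0' i) (hq0 i)
      linarith
  calc _ ≤ sampleExp p (fun S => sampleExp q fun W =>
        ∑ T, ∑ c ∈ 𝓒 T, Real.exp (-(lam * t)) * ∏ i, F T c i (i ∈ S) (i ∈ W)) :=
        sampleExp_mono hp0' hp1 fun S => sampleExp_mono hq0 hq1 fun W => by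
          convert hpt S W
    _ = ∑ T, ∑ c ∈ 𝓒 T, Real.exp (-(lam * t)) *
        sampleExp p (fun S => sampleExp q fun W => ∏ i, F T c i (i ∈ S) (i ∈ W)) := by
        simp_rw [sampleExp_sum, sampleExp_mul_left]
    _ ≤ ∑ T : Finset V, ∑ c ∈ 𝓒 T, Real.exp (-(lam * t)) * (Real.exp (lam ^ 2 * R * L) *
        ∏ i, (if i ∈ T then Real.exp 1 * (p i * q i) else 1 - p i * q i)) := by
        refine Finset.sum_le_sum fun T _ => Finset.sum_le_sum fun c hc => ?_
        exact mul_le_mul_of_nonneg_left (hfac T c hc) (Real.exp_pos _).le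
    _ = ∑ T : Finset V, Real.exp (lam ^ 2 * R * L - lam * t) * (((𝓒 T).card : ℝ) *
        ∏ i, (if i ∈ T then Real.exp 1 * (p i * q i) else 1 - p i * q i)) := by
        refine Finset.sum_congr rfl fun T _ => ?_
        rw [Finset.sum_const, nsmul_eq_mul, sub_eq_add_neg, Real.exp_add]
        ring
    _ ≤ ∑ T : Finset V, Real.exp (lam ^ 2 * R * L - lam * t) * (K ^ T.card *
        ∏ i, (if i ∈ T then Real.exp 1 * (p i * q i) else 1 - p i * q i)) := by
        refine Finset.sum_le_sum fun T _ => ?_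
        gcongr
        · refine Finset.prod_nonneg fun i _ => ?_
          split_ifs
          · have := hq0 i; have := hp0' i; positivity
          · exact sub_nonneg.2 (mul_le_one₀ (hp1 i) (hq0 i) (hq1 i))
        · exact hcard T
    _ = Real.exp (lam ^ 2 * R * L - lam * t) * ∑ T : Finset V, (K ^ T.card *
        ∏ i, (if i ∈ T then Real.exp 1 * (p i * q i) else 1 - p i * q i)) := by
        rw [Finset.mul_sum]
    _ ≤ Real.exp (lam ^ 2 * R * L - lam * t) * Real.exp (K * Real.exp 1 * ∑ i, p i * q i) := by
        gcongr
    _ = _ := by rw [← Real.exp_add]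

end TwoStage

/-! ### Importance sampling of a signed graph -/

/-- A signed weighted graph `M` on `V`, with `|M i j| ≤ 1` and average absolute degree `Δ`,
together with inclusion probabilities `p` that dominate the importance scores at scale `α`. The
parameter `k` bounds the number of colors; `hα` is the sample size that `k` colors and accuracy
`ε` call for. -/
structure ImportanceSampling (V : Type*) [Fintype V] where
  two_le_card : 2 ≤ Fintype.card V
  M : V → V → ℝ
  symm : ∀ i j, M i j = M j i
  diag : ∀ i, M i i = 0
  abs_le_one : ∀ i j, |M i j| ≤ 1
  Δ : ℝ
  Δ_pos : 0 < Δ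
  sum_abs : ∑ i, ∑ j, |M i j| = Fintype.card V * Δ
  ε : ℝ
  ε_pos : 0 < ε
  ε_lt_one : ε < 1
  k : ℝ
  one_le_k : 1 ≤ k
  α : ℝ
  α_pos : 0 < α
  hα : 10 ^ 12 * k * Real.log (Fintype.card V) * α ≤ ε ^ 4
  p : V → ℝ
  p_pos : ∀ i, 0 < p i
  p_le_one : ∀ i, p i ≤ 1
  score_le : ∀ i, p i = 1 ∨ max (∑ j, |M i j|) (ε * Δ) ≤ Δ ^ 2 * α * p i

namespace ImportanceSampling

variable {V : Type*} [Fintype V] (I : ImportanceSampling V)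

/-- The absolute degree of `i`. -/
def deg (i : V) : ℝ := ∑ j, |I.M i j|

/-- The number of vertices, as a real number. -/
def n (_I : ImportanceSampling V) : ℝ := Fintype.card V

/-- The truncated degree `max {d_i, ε Δ}`, the numerator of the importance score. -/
def mass (i : V) : ℝ := max (I.deg i) (I.ε * I.Δ)

/-- The normalized indicator `1_{i ∈ S} / p_i`. -/
def X (S : Finset V) (i : V) : ℝ := invIndicator I.p S i

/-- The relative accuracy demanded of linear statistics of the sample. -/
def δ : ℝ := I.ε / 200

theorem p_nonneg (i : V) : 0 ≤ I.p i := (I.p_pos i).le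

theorem X_nonneg (S : Finset V) (i : V) : 0 ≤ I.X S i := invIndicator_nonneg I.p_nonneg S i

theorem deg_nonneg (i : V) : 0 ≤ I.deg i := Finset.sum_nonneg fun _ _ => abs_nonneg _

theorem sum_deg : ∑ i, I.deg i = I.n * I.Δ := I.sum_abs

theorem deg_le_mass (i : V) : I.deg i ≤ I.mass i := le_max_left _ _

theorem ε_mul_Δ_le_mass (i : V) : I.ε * I.Δ ≤ I.mass i := le_max_right _ _

theorem ε_mul_Δ_pos : 0 < I.ε * I.Δ := mul_pos I.ε_pos I.Δ_pos

theorem mass_pos (i : V) : 0 < I.mass i := I.ε_mul_Δ_pos.trans_le (I.ε_mul_Δ_le_mass i)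

theorem mass_le (i : V) : I.p i = 1 ∨ I.mass i ≤ I.Δ ^ 2 * I.α * I.p i := I.score_le i

theorem two_le_n : 2 ≤ I.n := by
  rw [n]; exact_mod_cast I.two_le_card

theorem n_pos : 0 < I.n := by linarith [I.two_le_n]

theorem Δ_le_n : I.Δ ≤ I.n := by
  have h : I.n * I.Δ ≤ I.n * I.n := by
    calc I.n * I.Δ = ∑ i, ∑ j, |I.M i j| := I.sum_abs.symm
      _ ≤ ∑ _i : V, ∑ _j : V, (1 : ℝ) :=
        Finset.sum_le_sum fun i _ => Finset.sum_le_sum fun j _ => I.abs_le_one i j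
      _ = I.n * I.n := by simp [n]
  exact le_of_mul_le_mul_left h I.n_pos

theorem half_le_log : 1 / 2 ≤ Real.log I.n := by
  have h1 : Real.log 2 ≤ Real.log I.n := Real.log_le_log (by norm_num) I.two_le_n
  linarith [Real.log_two_gt_d9]

/-- The sample size is far beyond what linear statistics need. -/
theorem mul_log_mul_α_le : 10 ^ 12 * (Real.log I.n * I.α) ≤ I.ε ^ 3 := by
  have h1 : 10 ^ 12 * (Real.log I.n * I.α) ≤ 10 ^ 12 * I.k * Real.log I.n * I.α := by
    have h := mul_nonneg (by linarith [I.half_le_log] : 0 ≤ Real.log I.n) I.α_pos.le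
    nlinarith [I.one_le_k]
  have h2 : I.ε ^ 4 ≤ I.ε ^ 3 := pow_le_pow_of_le_one I.ε_pos.le I.ε_lt_one.le (by norm_num)
  exact h1.trans (I.hα.trans h2)

/-- The probability that each of the bad events is allowed to have. -/
def η : ℝ := Real.exp (-(8 * Real.log I.n))

theorem exp_le_η {x : ℝ} (hx : x + I.ε ^ 3 / (10 ^ 11 * I.α) ≤ 0) : Real.exp x ≤ I.η := by
  refine Real.exp_le_exp.2 ?_
  have h : 8 * Real.log I.n ≤ I.ε ^ 3 / (10 ^ 11 * I.α) := by
    rw [le_div_iff₀ (by have := I.α_pos; positivity)]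
    have := I.mul_log_mul_α_le
    have := mul_nonneg (by linarith [I.half_le_log] : 0 ≤ Real.log I.n) I.α_pos.le
    linarith
  linarith

/-- Concentration of a row of a matrix dominated by `M`. -/
theorem prob_row_le {w : V → ℝ} {i : V} (hw : ∀ j, |w j| ≤ |I.M i j|) :
    prob I.p (fun S => I.δ * (I.deg i + I.Δ) ≤ |∑ j, (I.X S j - 1) * w j|) ≤ 2 * I.η := by
  have hε := I.ε_pos; have hΔ := I.Δ_pos; have hα := I.α_pos; have hε1 := I.ε_lt_one
  set R := I.Δ * I.α / I.ε with hR
  have hRpos : 0 < R := by positivity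
  have h := prob_abs_tail_le I.p_pos I.p_le_one (f := w) (R := R) (L := I.deg i)
    (lam := I.δ / (2 * R)) (t := I.δ * (I.deg i + I.Δ)) (fun j => ?_) hRpos.le
    (Finset.sum_le_sum fun j _ => hw j) (by rw [δ]; positivity) ?_
  · refine h.trans ?_
    gcongr
    refine I.exp_le_η ?_
    have hd := I.deg_nonneg i
    have e1 : (I.δ / (2 * R)) ^ 2 * R * I.deg i - I.δ / (2 * R) * (I.δ * (I.deg i + I.Δ)) =
        -(I.δ ^ 2 / (4 * R) * I.deg i) - I.δ ^ 2 * I.Δ / (2 * R) := by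
      field_simp; ring
    have e2 : I.δ ^ 2 * I.Δ / (2 * R) = I.ε ^ 3 / (80000 * I.α) := by
      rw [hR, δ]; field_simp; norm_num
    have e3 : I.ε ^ 3 / (10 ^ 11 * I.α) ≤ I.ε ^ 3 / (80000 * I.α) := by gcongr; norm_num
    have e4 : 0 ≤ I.δ ^ 2 / (4 * R) * I.deg i := by positivity
    rw [e1, e2]; linarith
  · rcases I.mass_le j with hj | hj
    · exact Or.inl hj
    · refine Or.inr (((hw j).trans (I.abs_le_one i j)).trans ?_)
      rw [hR, div_mul_eq_mul_div, le_div_iff₀ hε]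
      have h1 := (I.ε_mul_Δ_le_mass j).trans hj
      have h2 : I.Δ * I.ε ≤ I.Δ * (I.Δ * I.α * I.p j) := by linarith
      linarith [le_of_mul_le_mul_left h2 hΔ]
  · have : I.δ / (2 * R) * R = I.δ / 2 := by field_simp
    rw [this, δ]; linarith

/-- Concentration of a linear statistic whose coefficients are at most `d_i + Δ`. -/
theorem prob_linear_le {f : V → ℝ} (hf : ∀ i, |f i| ≤ I.deg i + I.Δ) :
    prob I.p (fun S => I.δ * (I.n * I.Δ) ≤ |∑ i, (I.X S i - 1) * f i|) ≤ 2 * I.η := by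
  have hε := I.ε_pos; have hΔ := I.Δ_pos; have hα := I.α_pos; have hε1 := I.ε_lt_one
  have hn := I.n_pos
  set R := 2 * I.Δ ^ 2 * I.α / I.ε with hR
  have hRpos : 0 < R := by positivity
  have h := prob_abs_tail_le I.p_pos I.p_le_one (f := f) (R := R) (L := 2 * (I.n * I.Δ))
    (lam := I.δ / (4 * R)) (t := I.δ * (I.n * I.Δ)) (fun j => ?_) hRpos.le ?_
    (by rw [δ]; positivity) ?_
  · refine h.trans ?_
    gcongr
    refine I.exp_le_η ?_
    have e1 : (I.δ / (4 * R)) ^ 2 * R * (2 * (I.n * I.Δ)) - I.δ / (4 * R) * (I.δ * (I.n * I.Δ)) =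
        -(I.ε ^ 3 / (640000 * I.α) * (I.n / I.Δ)) := by
      rw [hR, δ]; field_simp; ring
    have e3 : I.ε ^ 3 / (10 ^ 11 * I.α) ≤ I.ε ^ 3 / (640000 * I.α) * 1 := by
      rw [mul_one]; gcongr; norm_num
    have e4 : 1 ≤ I.n / I.Δ := (one_le_div hΔ).2 I.Δ_le_n
    have e5 : I.ε ^ 3 / (640000 * I.α) * 1 ≤ I.ε ^ 3 / (640000 * I.α) * (I.n / I.Δ) := by gcongr
    rw [e1]; linarith
  · rcases I.mass_le j with hj | hj
    · exact Or.inl hj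
    · refine Or.inr ((hf j).trans ?_)
      rw [hR, div_mul_eq_mul_div, le_div_iff₀ hε]
      have h1 := I.ε_mul_Δ_le_mass j
      have h2 := I.deg_le_mass j
      have h3 := I.deg_nonneg j
      nlinarith
  · calc _ ≤ ∑ i, (I.deg i + I.Δ) := Finset.sum_le_sum fun i _ => hf i
      _ = _ := by rw [Finset.sum_add_distrib, I.sum_deg]; simp [n]; ring
  · have : I.δ / (4 * R) * R = I.δ / 4 := by field_simp
    rw [this, δ]; linarith

/-- The linear statistics of the matrix `w` that the sample `S` has to preserve: its row sums, up
to a small part of `d_i + Δ`, and its total weight as a sum of row sums. -/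
def Spread (w : V → V → ℝ) (S : Finset V) : Prop :=
  (∀ i, |∑ j, (I.X S j - 1) * w i j| < I.δ * (I.deg i + I.Δ)) ∧
    |∑ i, (I.X S i - 1) * ∑ j, w i j| < I.δ * (I.n * I.Δ)

theorem prob_not_spread_le {w : V → V → ℝ} (hw : ∀ i j, |w i j| ≤ |I.M i j|) :
    prob I.p (fun S => ¬ I.Spread w S) ≤ (2 * I.n + 2) * I.η := by
  have h1 : prob I.p (fun S => ¬ I.Spread w S) ≤
      prob I.p (fun S => (∃ i, I.δ * (I.deg i + I.Δ) ≤ |∑ j, (I.X S j - 1) * w i j|) ∨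
        I.δ * (I.n * I.Δ) ≤ |∑ i, (I.X S i - 1) * ∑ j, w i j|) := by
    refine prob_mono I.p_nonneg I.p_le_one fun S hS => ?_
    rw [Spread, not_and_or] at hS
    push Not at hS
    exact hS
  have h2 := prob_exists_le I.p_nonneg I.p_le_one
    (fun i S => I.δ * (I.deg i + I.Δ) ≤ |∑ j, (I.X S j - 1) * w i j|)
  have h3 : ∑ i, prob I.p (fun S => I.δ * (I.deg i + I.Δ) ≤ |∑ j, (I.X S j - 1) * w i j|) ≤
      ∑ _i : V, 2 * I.η := Finset.sum_le_sum fun i _ => I.prob_row_le (hw i)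
  have h4 := I.prob_linear_le (f := fun i => ∑ j, w i j) fun i => by
    have := (Finset.abs_sum_le_sum_abs (w i) Finset.univ).trans
      (Finset.sum_le_sum fun j _ => hw i j)
    have h5 := I.Δ_pos
    rw [deg]; linarith
  have h6 := prob_or_le I.p_nonneg I.p_le_one
    (fun S => ∃ i, I.δ * (I.deg i + I.Δ) ≤ |∑ j, (I.X S j - 1) * w i j|)
    (fun S => I.δ * (I.n * I.Δ) ≤ |∑ i, (I.X S i - 1) * ∑ j, w i j|)
  have h7 : ∑ _i : V, 2 * I.η = 2 * I.n * I.η := by simp [n]; ring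
  linarith

/-- The sample `S` preserves the absolute degrees and the number of vertices. -/
def Balanced (S : Finset V) : Prop :=
  I.Spread (fun i j => |I.M i j|) S ∧ |∑ i, (I.X S i - 1) * I.Δ| < I.δ * (I.n * I.Δ)

theorem prob_not_balanced_le : prob I.p (fun S => ¬ I.Balanced S) ≤ (2 * I.n + 4) * I.η := by
  have h1 := I.prob_not_spread_le (w := fun i j => |I.M i j|) (fun i j => by rw [abs_abs])
  have h2 := I.prob_linear_le (f := fun _ => I.Δ) fun i => by
    rw [abs_of_pos I.Δ_pos]; linarith [I.deg_nonneg i]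
  have h3 := prob_or_le I.p_nonneg I.p_le_one
    (fun S => ¬ I.Spread (fun i j => |I.M i j|) S)
    (fun S => I.δ * (I.n * I.Δ) ≤ |∑ i, (I.X S i - 1) * I.Δ|)
  have h4 : prob I.p (fun S => ¬ I.Balanced S) ≤
      prob I.p (fun S => ¬ I.Spread (fun i j => |I.M i j|) S ∨
        I.δ * (I.n * I.Δ) ≤ |∑ i, (I.X S i - 1) * I.Δ|) := by
    refine prob_mono I.p_nonneg I.p_le_one fun S hS => ?_
    rw [Balanced, not_and_or, not_lt] at hS
    exact hS
  linarith

variable {I}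

theorem Balanced.abs_deg {S : Finset V} (h : I.Balanced S) :
    |∑ i, (I.X S i - 1) * I.deg i| < I.δ * (I.n * I.Δ) := h.1.2

theorem Balanced.sum_X_mul_deg {S : Finset V} (h : I.Balanced S) :
    ∑ i, I.X S i * I.deg i ≤ (1 + I.δ) * (I.n * I.Δ) := by
  have h1 := (abs_lt.1 h.abs_deg).2
  have h2 : ∑ i, (I.X S i - 1) * I.deg i = ∑ i, I.X S i * I.deg i - I.n * I.Δ := by
    rw [← I.sum_deg, ← Finset.sum_sub_distrib]
    exact Finset.sum_congr rfl fun i _ => by ring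
  linarith

theorem Balanced.sum_X {S : Finset V} (h : I.Balanced S) :
    ∑ i, I.X S i ≤ (1 + I.δ) * I.n := by
  have h1 := (abs_lt.1 h.2).2
  have h2 : ∑ i, (I.X S i - 1) * I.Δ = (∑ i, I.X S i - I.n) * I.Δ := by
    rw [← Finset.sum_mul, Finset.sum_sub_distrib]; simp [n]
  have h3 : (∑ i, I.X S i) * I.Δ ≤ (1 + I.δ) * I.n * I.Δ := by linarith
  exact le_of_mul_le_mul_right h3 I.Δ_pos

theorem Balanced.row_le {S : Finset V} (h : I.Balanced S) (i : V) :
    ∑ j, I.X S j * |I.M i j| ≤ 2 * I.deg i + I.ε * I.Δ := by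
  have h1 := (abs_lt.1 (h.1.1 i)).2
  have h2 : ∑ j, (I.X S j - 1) * |I.M i j| = ∑ j, I.X S j * |I.M i j| - I.deg i := by
    rw [deg, ← Finset.sum_sub_distrib]
    exact Finset.sum_congr rfl fun i _ => by ring
  have h3 := I.deg_nonneg i; have hΔ := I.Δ_pos; have hε := I.ε_pos; have hε1 := I.ε_lt_one
  rw [δ] at h1
  nlinarith [mul_pos hε hΔ]

/-- A fixed quadratic statistic is preserved as soon as the linear ones are. -/
theorem Balanced.abs_quadratic_sub_le {S : Finset V} (h : I.Balanced S) {w : V → V → ℝ}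
    (hw : I.Spread w S) :
    |∑ i, ∑ j, I.X S i * I.X S j * w i j - ∑ i, ∑ j, w i j| ≤ I.ε / 40 * (I.n * I.Δ) := by
  have hε := I.ε_pos; have hε1 := I.ε_lt_one
  have hnΔ : 0 < I.n * I.Δ := mul_pos I.n_pos I.Δ_pos
  have e : ∑ i, ∑ j, I.X S i * I.X S j * w i j - ∑ i, ∑ j, w i j =
      ∑ i, I.X S i * (∑ j, (I.X S j - 1) * w i j) + ∑ i, (I.X S i - 1) * ∑ j, w i j := by
    rw [← Finset.sum_add_distrib, ← Finset.sum_sub_distrib]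
    refine Finset.sum_congr rfl fun i _ => ?_
    rw [Finset.mul_sum, Finset.mul_sum, ← Finset.sum_add_distrib, ← Finset.sum_sub_distrib]
    exact Finset.sum_congr rfl fun j _ => by ring
  have h1 : |∑ i, I.X S i * (∑ j, (I.X S j - 1) * w i j)| ≤
      ∑ i, I.X S i * (I.δ * (I.deg i + I.Δ)) := by
    refine (Finset.abs_sum_le_sum_abs _ _).trans (Finset.sum_le_sum fun i _ => ?_)
    rw [abs_mul, abs_of_nonneg (I.X_nonneg S i)]
    exact mul_le_mul_of_nonneg_left (hw.1 i).le (I.X_nonneg S i)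
  have h2 : ∑ i, I.X S i * (I.δ * (I.deg i + I.Δ)) =
      I.δ * (∑ i, I.X S i * I.deg i + (∑ i, I.X S i) * I.Δ) := by
    rw [Finset.sum_mul, ← Finset.sum_add_distrib, Finset.mul_sum]
    exact Finset.sum_congr rfl fun j _ => by ring
  have h3 := h.sum_X_mul_deg
  have h4 := mul_le_mul_of_nonneg_right h.sum_X I.Δ_pos.le
  have hδ : I.δ = I.ε / 200 := rfl
  have h5 : I.δ * (∑ i, I.X S i * I.deg i + (∑ i, I.X S i) * I.Δ) ≤
      I.δ * (4 * (I.n * I.Δ)) := by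
    have : 0 ≤ I.δ := by rw [hδ]; positivity
    apply mul_le_mul_of_nonneg_left _ this
    nlinarith
  have h6 := hw.2.le
  rw [e]
  refine (abs_add_le _ _).trans ?_
  rw [h2] at h1
  have h7 := h1.trans h5
  rw [hδ] at h6 h7
  linarith

end ImportanceSampling

/-! ### Guessing the field of a coloring from a subsample -/

namespace ImportanceSampling

variable {V : Type*} [Fintype V] (I : ImportanceSampling V)

/-- The scale of the subsample, coarser than `α` by a factor of order at least
`k log n / ε ^ 2`. -/
def subα : ℝ := I.ε ^ 2 / 30000

/-- The probability that a vertex belongs to the subsample. -/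
def subp (i : V) : ℝ := min 1 (I.mass i / (I.Δ ^ 2 * I.subα))

/-- The probability that a sampled vertex is kept in the subsample. -/
def q (i : V) : ℝ := I.subp i / I.p i

theorem subα_pos : 0 < I.subα := by
  have := I.ε_pos
  rw [subα]; positivity

theorem scale_pos : 0 < I.Δ ^ 2 * I.subα := mul_pos (pow_pos I.Δ_pos 2) I.subα_pos

theorem subp_pos (i : V) : 0 < I.subp i :=
  lt_min one_pos (div_pos (I.mass_pos i) I.scale_pos)

theorem α_le_subα : I.α ≤ I.subα := by
  have h1 := I.mul_log_mul_α_le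
  have h2 := mul_le_mul_of_nonneg_right I.half_le_log I.α_pos.le
  have h3 : I.ε ^ 3 ≤ I.ε ^ 2 := pow_le_pow_of_le_one I.ε_pos.le I.ε_lt_one.le (by norm_num)
  have h4 := I.α_pos
  rw [subα]; linarith

theorem subp_le_p (i : V) : I.subp i ≤ I.p i := by
  rcases I.mass_le i with h | h
  · rw [h]; exact min_le_left _ _
  · refine (min_le_right _ _).trans ?_
    rw [div_le_iff₀ I.scale_pos]
    have h1 : I.Δ ^ 2 * I.α * I.p i ≤ I.Δ ^ 2 * I.subα * I.p i := by
      have := I.α_le_subα; have := I.p_nonneg i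
      gcongr
    linarith

theorem q_pos (i : V) : 0 < I.q i := div_pos (I.subp_pos i) (I.p_pos i)

theorem q_le_one (i : V) : I.q i ≤ 1 := (div_le_one (I.p_pos i)).2 (I.subp_le_p i)

theorem p_mul_q (i : V) : I.p i * I.q i = I.subp i := mul_div_cancel₀ _ (I.p_pos i).ne'

theorem inv_p_mul_inv_q_sub_one_le (i : V) :
    (I.p i)⁻¹ * ((I.q i)⁻¹ - 1) ≤ I.Δ ^ 2 * I.subα / I.mass i := by
  have hp := I.p_pos i
  have hm := I.mass_pos i
  have hs := I.scale_pos
  by_cases h : 1 ≤ I.mass i / (I.Δ ^ 2 * I.subα)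
  · have h1 : I.subp i = 1 := min_eq_left h
    have h2 : I.p i = 1 := le_antisymm (I.p_le_one i) (h1 ▸ I.subp_le_p i)
    have h3 : I.q i = 1 := by rw [q, h1, h2, div_one]
    rw [h2, h3]; simp; positivity
  · have h1 : I.subp i = I.mass i / (I.Δ ^ 2 * I.subα) := min_eq_right (not_le.1 h).le
    have h2 : (I.p i)⁻¹ * (I.q i)⁻¹ = I.Δ ^ 2 * I.subα / I.mass i := by
      rw [← mul_inv, p_mul_q, h1, inv_div]
    rw [mul_sub, h2]
    have := inv_pos.2 hp
    linarith

theorem sum_subp_le : ∑ i, I.subp i ≤ 60000 * (I.n / I.Δ) / I.ε ^ 2 := by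
  have hε := I.ε_pos; have hΔ := I.Δ_pos; have hε1 := I.ε_lt_one; have hn := I.n_pos
  have h1 : ∑ i, I.subp i ≤ ∑ i, (I.deg i + I.ε * I.Δ) / (I.Δ ^ 2 * I.subα) := by
    refine Finset.sum_le_sum fun i _ => (min_le_right _ _).trans ?_
    have := I.scale_pos
    gcongr
    exact max_le (by linarith [I.ε_mul_Δ_pos]) (by linarith [I.deg_nonneg i])
  have h2 : ∑ i, (I.deg i + I.ε * I.Δ) / (I.Δ ^ 2 * I.subα) =
      (I.n * I.Δ + I.n * (I.ε * I.Δ)) / (I.Δ ^ 2 * I.subα) := by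
    rw [← Finset.sum_div, Finset.sum_add_distrib, I.sum_deg]; simp [n]
  have h3 : (I.n * I.Δ + I.n * (I.ε * I.Δ)) / (I.Δ ^ 2 * I.subα) ≤
      2 * (I.n * I.Δ) / (I.Δ ^ 2 * I.subα) := by
    have := I.scale_pos
    gcongr
    nlinarith [mul_pos hn hΔ]
  have h4 : 2 * (I.n * I.Δ) / (I.Δ ^ 2 * I.subα) = 60000 * (I.n / I.Δ) / I.ε ^ 2 := by
    rw [subα]; field_simp; norm_num
  linarith

variable {κ : Type*}

open Classical in
/-- The error of the estimate of the field of the coloring `y` at `i` and color `a`, made by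
keeping the sampled vertices in `W` only. -/
def fieldError (S W : Finset V) (y : V → κ) (i : V) (a : κ) : ℝ :=
  ∑ j, (if y j = a then I.X S j * I.M i j else 0) * (invIndicator I.q W j - 1)

variable {I} in
/-- The variances of the estimates, summed over the vertices and the colors, are at most
`8 n Δ² ε² / 30000`: the weight that a row of `M` puts on a vertex `j` is compensated by the
factor `1 / max {d_j, ε Δ}` of the importance score. -/
theorem Balanced.sampleExp_fieldError_sq_le [Fintype κ] {S : Finset V} (h : I.Balanced S)
    (y : V → κ) :
    sampleExp I.q (fun W => ∑ i, (1 + I.X S i) * ∑ a, I.fieldError S W y i a ^ 2) ≤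
      8 * (I.n * (I.Δ ^ 2 * I.subα)) := by
  classical
  have hε := I.ε_pos; have hΔ := I.Δ_pos; have hε1 := I.ε_lt_one; have hn := I.n_pos
  have hs := I.scale_pos
  have h1 : sampleExp I.q (fun W => ∑ i, (1 + I.X S i) * ∑ a, I.fieldError S W y i a ^ 2) =
      ∑ i, (1 + I.X S i) * ∑ j, (I.X S j * I.M i j) ^ 2 * ((I.q j)⁻¹ - 1) := by
    rw [sampleExp_sum]
    refine Finset.sum_congr rfl fun i _ => ?_
    rw [sampleExp_mul_left, sampleExp_sum]
    congr 1
    simp only [fieldError]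
    simp_rw [sampleExp_sq_sum I.q_pos]
    rw [Finset.sum_comm]
    refine Finset.sum_congr rfl fun j _ => ?_
    simp [ite_pow]
  have h2 : ∀ i j, (I.X S j * I.M i j) ^ 2 * ((I.q j)⁻¹ - 1) ≤
      I.X S j * |I.M i j| * (I.Δ ^ 2 * I.subα / I.mass j) := by
    intro i j
    have hq : 0 ≤ (I.q j)⁻¹ - 1 := sub_nonneg.2 ((one_le_inv₀ (I.q_pos j)).2 (I.q_le_one j))
    have hM : I.M i j ^ 2 ≤ |I.M i j| := by
      rw [← sq_abs]
      nlinarith [I.abs_le_one i j, abs_nonneg (I.M i j)]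
    have hX : I.X S j ^ 2 * ((I.q j)⁻¹ - 1) ≤ I.X S j * (I.Δ ^ 2 * I.subα / I.mass j) := by
      have h3 : I.X S j ≤ (I.p j)⁻¹ := by
        rw [X, invIndicator_eq]
        split_ifs
        · exact le_rfl
        · exact inv_nonneg.2 (I.p_nonneg j)
      calc I.X S j ^ 2 * ((I.q j)⁻¹ - 1) = I.X S j * (I.X S j * ((I.q j)⁻¹ - 1)) := by ring
        _ ≤ I.X S j * ((I.p j)⁻¹ * ((I.q j)⁻¹ - 1)) := by
            have := I.X_nonneg S j
            gcongr
        _ ≤ _ := by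
            have := I.X_nonneg S j
            gcongr
            exact I.inv_p_mul_inv_q_sub_one_le j
    calc _ = I.M i j ^ 2 * (I.X S j ^ 2 * ((I.q j)⁻¹ - 1)) := by ring
      _ ≤ |I.M i j| * (I.X S j * (I.Δ ^ 2 * I.subα / I.mass j)) := by gcongr
      _ = _ := by ring
  have h3 : ∀ j, I.Δ ^ 2 * I.subα / I.mass j *
      (I.deg j + ∑ i, I.X S i * |I.M j i|) ≤ 4 * (I.Δ ^ 2 * I.subα) := by
    intro j
    have hm := I.mass_pos j
    rw [div_mul_eq_mul_div, div_le_iff₀ hm]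
    have : I.deg j + ∑ i, I.X S i * |I.M j i| ≤ 4 * I.mass j := by
      linarith [h.row_le j, I.deg_le_mass j, I.ε_mul_Δ_le_mass j]
    nlinarith
  calc _ = _ := h1
    _ ≤ ∑ i, (1 + I.X S i) * ∑ j, I.X S j * |I.M i j| * (I.Δ ^ 2 * I.subα / I.mass j) := by
        refine Finset.sum_le_sum fun i _ => ?_
        have := I.X_nonneg S i
        exact mul_le_mul_of_nonneg_left (Finset.sum_le_sum fun j _ => h2 i j) (by linarith)
    _ = ∑ j, I.X S j * (I.Δ ^ 2 * I.subα / I.mass j *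
          (I.deg j + ∑ i, I.X S i * |I.M j i|)) := by
        simp_rw [Finset.mul_sum]
        rw [Finset.sum_comm]
        refine Finset.sum_congr rfl fun j _ => ?_
        rw [deg, ← Finset.sum_add_distrib, Finset.mul_sum, Finset.mul_sum]
        refine Finset.sum_congr rfl fun i _ => ?_
        rw [I.symm j i]; ring
    _ ≤ ∑ j, I.X S j * (4 * (I.Δ ^ 2 * I.subα)) :=
        Finset.sum_le_sum fun j _ => mul_le_mul_of_nonneg_left (h3 j) (I.X_nonneg S j)
    _ = (∑ j, I.X S j) * (4 * (I.Δ ^ 2 * I.subα)) := by rw [Finset.sum_mul]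
    _ ≤ (2 * I.n) * (4 * (I.Δ ^ 2 * I.subα)) := by
        have h4 := h.sum_X
        gcongr
        rw [δ] at h4
        nlinarith
    _ = _ := by ring

open Classical in
/-- The certificate in the form used for the sample. For a guess `b` of the field, `c i` is the
value of the best color of `i` against the dual certificate `z` of `b`, shifted by `3 d_i + ε Δ` to
make it nonnegative. A coloring of the sample whose field is close to `b` beats `s` by no more than
the excess of `∑ c i / p i` over `∑ c i`. -/
theorem exists_certificate [Fintype κ] [Nonempty κ] {s : ℝ}
    (hs : ∀ f : V → κ, ∑ i, ∑ j, (if f i = f j then I.M i j else 0) ≤ s) {b : V → κ → ℝ}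
    (hb : ∀ i a, |b i a| ≤ 2 * I.deg i + I.ε * I.Δ) :
    ∃ c : V → ℝ, (∀ i, 0 ≤ c i) ∧ (∀ i, c i ≤ 2 * (3 * I.deg i + I.ε * I.Δ)) ∧
      ∀ X : V → ℝ, (∀ i, 0 ≤ X i) → ∀ (y : V → κ) (e : V → ℝ),
        (∀ i a, |∑ j, (if y j = a then X j * I.M i j else 0) - b i a| ≤ e i) →
        ∑ i, ∑ j, (if y i = y j then X i * X j * I.M i j else 0) - s ≤
          ∑ i, (X i - 1) * c i - ∑ i, (X i - 1) * (3 * I.deg i + I.ε * I.Δ) +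
            ∑ i, (1 + X i) * e i := by
  obtain ⟨z, hz, hzs⟩ := exists_dual_certificate I.diag hs b
  have hz0 : ∀ i a, 0 ≤ z i a := fun i a => (hz i trivial).1 a
  have hz1 : ∀ i, ∑ a, z i a = 1 := fun i => (hz i trivial).2
  have hzle : ∀ i a, z i a ≤ 1 := fun i a =>
    hz1 i ▸ Finset.single_le_sum (f := z i) (fun a _ => hz0 i a) (Finset.mem_univ a)
  set h : V → κ → ℝ := fun i a => b i a + ∑ j, I.M i j * z j a with hh
  have hmax : ∀ i, ∃ a, ∀ a', h i a' ≤ h i a := fun i => Finite.exists_max (h i)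
  choose f hf using hmax
  have habs : ∀ i a, |h i a| ≤ 3 * I.deg i + I.ε * I.Δ := by
    intro i a
    have h1 : |∑ j, I.M i j * z j a| ≤ I.deg i := by
      refine (Finset.abs_sum_le_sum_abs _ _).trans (Finset.sum_le_sum fun j _ => ?_)
      rw [abs_mul, abs_of_nonneg (hz0 j a)]
      exact mul_le_of_le_one_right (abs_nonneg _) (hzle j a)
    have h2 := hb i a
    have h3 := abs_add_le (b i a) (∑ j, I.M i j * z j a)
    simp only [hh]
    linarith
  refine ⟨fun i => h i (f i) + (3 * I.deg i + I.ε * I.Δ), fun i => ?_, fun i => ?_, ?_⟩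
  · linarith [(abs_le.1 (habs i (f i))).1]
  · linarith [(abs_le.1 (habs i (f i))).2]
  intro X hX y e he
  set g : V → κ → ℝ := fun i a => ∑ j, (if y j = a then X j * I.M i j else 0) with hg
  have e1 : ∑ i, ∑ j, (if y i = y j then X i * X j * I.M i j else 0) = ∑ i, X i * g i (y i) := by
    refine Finset.sum_congr rfl fun i _ => ?_
    rw [hg, Finset.mul_sum]
    refine Finset.sum_congr rfl fun j _ => ?_
    by_cases hij : y i = y j
    · simp [hij, mul_assoc]
    · simp [hij, Ne.symm hij]
  have e2 : ∑ i, X i * ∑ j, I.M i j * z j (y i) = ∑ i, ∑ a, z i a * g i a := by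
    simp_rw [Finset.mul_sum]
    rw [Finset.sum_comm]
    refine Finset.sum_congr rfl fun j _ => ?_
    simp_rw [hg, Finset.mul_sum]
    rw [Finset.sum_comm]
    refine Finset.sum_congr rfl fun i _ => ?_
    simp only [mul_ite, mul_zero, Finset.sum_ite_eq, Finset.mem_univ, if_true]
    rw [I.symm i j]; ring
  have h1 : ∑ i, X i * g i (y i) ≤ ∑ i, X i * b i (y i) + ∑ i, X i * e i := by
    rw [← Finset.sum_add_distrib]
    refine Finset.sum_le_sum fun i _ => ?_
    rw [← mul_add]
    exact mul_le_mul_of_nonneg_left (by linarith [(abs_le.1 (he i (y i))).2]) (hX i)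
  have h2 : ∑ i, ∑ a, z i a * b i a ≤ ∑ i, ∑ a, z i a * g i a + ∑ i, e i := by
    rw [← Finset.sum_add_distrib]
    refine Finset.sum_le_sum fun i _ => ?_
    calc ∑ a, z i a * b i a ≤ ∑ a, (z i a * g i a + z i a * e i) :=
          Finset.sum_le_sum fun a _ => by
            rw [← mul_add]
            exact mul_le_mul_of_nonneg_left (by linarith [(abs_le.1 (he i a)).1]) (hz0 i a)
      _ = _ := by rw [Finset.sum_add_distrib, ← Finset.sum_mul, hz1, one_mul]
  have h3 : ∑ i, X i * b i (y i) + ∑ i, X i * ∑ j, I.M i j * z j (y i) ≤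
      ∑ i, X i * h i (f i) := by
    rw [← Finset.sum_add_distrib]
    refine Finset.sum_le_sum fun i _ => ?_
    rw [← mul_add]
    exact mul_le_mul_of_nonneg_left (hf i (y i)) (hX i)
  have h4 : ∑ i, h i (f i) - ∑ i, ∑ a, z i a * b i a ≤ s := hzs f
  have e3 : ∑ i, (X i - 1) * (h i (f i) + (3 * I.deg i + I.ε * I.Δ)) =
      ∑ i, X i * h i (f i) - ∑ i, h i (f i) + ∑ i, (X i - 1) * (3 * I.deg i + I.ε * I.Δ) := by
    rw [← Finset.sum_sub_distrib, ← Finset.sum_add_distrib]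
    exact Finset.sum_congr rfl fun i _ => by ring
  have e4 : ∑ i, (1 + X i) * e i = ∑ i, e i + ∑ i, X i * e i := by
    rw [← Finset.sum_add_distrib]
    exact Finset.sum_congr rfl fun i _ => by ring
  rw [e1, e3, e4]
  linarith

theorem abs_sub_max_min_le {g x B : ℝ} (hg : |g| ≤ B) : |g - max (-B) (min B x)| ≤ |g - x| := by
  obtain ⟨h1, h2⟩ := abs_le.1 hg
  rcases le_total B x with h | h
  · rw [min_eq_left h, max_eq_right (by linarith), abs_sub_comm, abs_sub_comm g,
      abs_of_nonneg (by linarith), abs_of_nonneg (by linarith)]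
    linarith
  · rw [min_eq_right h]
    rcases le_total (-B) x with h' | h'
    · rw [max_eq_right h']
    · rw [max_eq_left h', abs_of_nonneg (by linarith), abs_of_nonneg (by linarith)]
      linarith

open Classical in
/-- The guess of the field from the colors of the vertices of the subsample `T`, truncated to the
range that balanced samples allow. -/
def guess (T : Finset V) (y : T → κ) (i : V) (a : κ) : ℝ :=
  max (-(2 * I.deg i + I.ε * I.Δ)) (min (2 * I.deg i + I.ε * I.Δ)
    (∑ j : T, if y j = a then (I.p j)⁻¹ * (I.q j)⁻¹ * I.M i j else 0))

theorem abs_guess_le (T : Finset V) (y : T → κ) (i : V) (a : κ) :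
    |I.guess T y i a| ≤ 2 * I.deg i + I.ε * I.Δ := by
  have h : 0 ≤ 2 * I.deg i + I.ε * I.Δ := by linarith [I.deg_nonneg i, I.ε_mul_Δ_pos]
  exact abs_le.2 ⟨le_max_left _ _, max_le (by linarith) (min_le_left _ _)⟩

variable {I} in
open Classical in
theorem Balanced.abs_field_sub_guess_le {S : Finset V} (h : I.Balanced S) (W : Finset V)
    (y : V → κ) (i : V) (a : κ) :
    |∑ j, (if y j = a then I.X S j * I.M i j else 0) -
      I.guess (S ∩ W) (fun j => y j) i a| ≤ |I.fieldError S W y i a| := by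
  have h1 : |∑ j, (if y j = a then I.X S j * I.M i j else 0)| ≤ 2 * I.deg i + I.ε * I.Δ := by
    refine (Finset.abs_sum_le_sum_abs _ _).trans ((Finset.sum_le_sum fun j _ => ?_).trans
      (h.row_le i))
    split_ifs
    · rw [abs_mul, abs_of_nonneg (I.X_nonneg S j)]
    · rw [abs_zero]; exact mul_nonneg (I.X_nonneg S j) (abs_nonneg _)
  refine (abs_sub_max_min_le h1).trans (le_of_eq ?_)
  rw [abs_sub_comm]
  congr 1
  have h2 : ∑ j : (S ∩ W : Finset V), (if y j = a then (I.p j)⁻¹ * (I.q j)⁻¹ * I.M i j else 0) =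
      ∑ j, (if y j = a then I.X S j * I.M i j else 0) * invIndicator I.q W j := by
    rw [Finset.sum_coe_sort (S ∩ W)
      (fun j => if y j = a then (I.p j)⁻¹ * (I.q j)⁻¹ * I.M i j else 0)]
    rw [← Finset.univ_inter (S ∩ W), ← Finset.sum_ite_mem]
    refine Finset.sum_congr rfl fun j _ => ?_
    rw [X, invIndicator_eq, invIndicator_eq]
    by_cases hS : j ∈ S <;> by_cases hW : j ∈ W <;> by_cases hy : y j = a <;>
      (simp [hS, hW, hy]; try ring)
  rw [h2, fieldError, ← Finset.sum_sub_distrib]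
  exact Finset.sum_congr rfl fun j _ => by ring

end ImportanceSampling

/-! ### No coloring of the sample beats the optimum -/

namespace ImportanceSampling

variable {V : Type*} [Fintype V] (I : ImportanceSampling V) {κ : Type*} [Fintype κ] [Nonempty κ]

/-- The exponential terms of the two-stage union bound are at most `η`: the deviation term, of
order `ε² n / (Δ α)`, absorbs the expected number of guesses, of order `exp (k n / (Δ ε²))`. -/
theorem exponent_le {lam : ℝ} (hlam : lam = I.ε / (400 * (8 * I.Δ ^ 2 * I.α))) :
    lam ^ 2 * (8 * I.Δ ^ 2 * I.α) * (8 * (I.n * I.Δ)) - lam * (I.ε / 25 * (I.n * I.Δ)) +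
      I.k * Real.exp 1 * ∑ i, I.p i * I.q i ≤ -(8 * Real.log I.n) := by
  have hε := I.ε_pos; have hΔ := I.Δ_pos; have hε1 := I.ε_lt_one; have hn := I.n_pos
  have hα := I.α_pos; have hk := I.one_le_k
  have hlog : 1 / 2 ≤ Real.log I.n := I.half_le_log
  have e1 : lam ^ 2 * (8 * I.Δ ^ 2 * I.α) * (8 * (I.n * I.Δ)) - lam * (I.ε / 25 * (I.n * I.Δ)) =
      -(I.ε ^ 2 / (160000 * I.α) * (I.n / I.Δ)) := by
    rw [hlam]; field_simp; ring
  set r := I.n / I.Δ with hr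
  have hr1 : 1 ≤ r := (one_le_div hΔ).2 I.Δ_le_n
  set ℓ := Real.log I.n with hℓ
  have h1 : 6 * 10 ^ 6 * (I.k * ℓ / I.ε ^ 2) ≤ I.ε ^ 2 / (160000 * I.α) := by
    rw [le_div_iff₀ (by positivity), ← mul_div_assoc, div_mul_eq_mul_div,
      div_le_iff₀ (by positivity)]
    have h2 : 10 ^ 12 * I.k * ℓ * I.α ≤ I.ε ^ 4 := I.hα
    have h3 : 0 ≤ I.k * ℓ * I.α := by positivity
    nlinarith
  have h2 : I.k * Real.exp 1 * ∑ i, I.p i * I.q i ≤ 180000 * (I.k / I.ε ^ 2) * r := by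
    simp_rw [p_mul_q]
    calc _ ≤ I.k * 3 * (60000 * r / I.ε ^ 2) := by
          have := I.sum_subp_le
          have h4 : Real.exp 1 ≤ 3 := by linarith [Real.exp_one_lt_d9]
          have h5 : 0 ≤ ∑ i, I.subp i := Finset.sum_nonneg fun i _ => (I.subp_pos i).le
          gcongr
      _ = _ := by ring
  have h3 : 6 * 10 ^ 6 * (I.k * ℓ / I.ε ^ 2) * r ≤ I.ε ^ 2 / (160000 * I.α) * r := by gcongr
  have h4 : 1 ≤ I.k / I.ε ^ 2 := by
    rw [one_le_div (by positivity)]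
    nlinarith
  have h5 : 1 ≤ I.k / I.ε ^ 2 * r := by nlinarith
  have h6 : 6 * 10 ^ 6 * (I.k * ℓ / I.ε ^ 2) * r = 6 * 10 ^ 6 * ℓ * (I.k / I.ε ^ 2 * r) := by ring
  rw [e1]
  nlinarith

open Classical in
/-- Let `s` bound the weight of the monochromatic pairs of every coloring of the signed graph. With
high probability the sample is not balanced or no coloring exceeds `s` on it by more than
`ε n Δ / 10`. -/
theorem prob_balanced_and_exceeds_le (hk : (Fintype.card κ : ℝ) ≤ I.k) {s : ℝ}
    (hs : ∀ f : V → κ, ∑ i, ∑ j, (if f i = f j then I.M i j else 0) ≤ s) :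
    prob I.p (fun S => I.Balanced S ∧ ∃ y : V → κ, s + I.ε / 10 * (I.n * I.Δ) <
      ∑ i, ∑ j, if y i = y j then I.X S i * I.X S j * I.M i j else 0) ≤ 2 * I.η := by
  have hε := I.ε_pos; have hΔ := I.Δ_pos; have hε1 := I.ε_lt_one; have hn := I.n_pos
  have hα := I.α_pos
  have hnΔ : 0 < I.n * I.Δ := mul_pos hn hΔ
  have hq0 := fun i => (I.q_pos i).le
  choose c hc0 hcle hcert using fun (T : Finset V) (y : T → κ) =>
    I.exists_certificate hs (b := I.guess T y) (I.abs_guess_le T y)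
  let 𝓒 : Finset V → Finset (V → ℝ) := fun T => Finset.univ.image (c T)
  -- A subsample within twice the expected squared error certifies the excess of `S`.
  have hgood : ∀ S, (I.Balanced S ∧ ∃ y : V → κ, s + I.ε / 10 * (I.n * I.Δ) <
      ∑ i, ∑ j, if y i = y j then I.X S i * I.X S j * I.M i j else 0) →
      1 / 2 ≤ prob I.q (fun W => ∃ c ∈ 𝓒 (S ∩ W),
        I.ε / 25 * (I.n * I.Δ) ≤ ∑ i, (invIndicator I.p S i - 1) * c i) := by
    rintro S ⟨hS, y, hy⟩
    set Z : Finset V → ℝ := fun W => ∑ i, (1 + I.X S i) * ∑ a, I.fieldError S W y i a ^ 2 with hZ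
    have hZ0 : ∀ W, 0 ≤ Z W := fun W => Finset.sum_nonneg fun i _ =>
      mul_nonneg (by linarith [I.X_nonneg S i]) (Finset.sum_nonneg fun a _ => sq_nonneg _)
    have hpos : 0 < 16 * (I.n * (I.Δ ^ 2 * I.subα)) := by
      have := I.scale_pos; positivity
    have h1 : prob I.q (fun W => 16 * (I.n * (I.Δ ^ 2 * I.subα)) ≤ Z W) ≤ 1 / 2 := by
      refine (prob_le_div hq0 I.q_le_one hZ0 hpos).trans ?_
      rw [div_le_iff₀ hpos]
      linarith [hS.sampleExp_fieldError_sq_le y]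
    have h2 := prob_add_prob_not I.q (fun W => 16 * (I.n * (I.Δ ^ 2 * I.subα)) ≤ Z W)
    have h3 : prob I.q (fun W => ¬ 16 * (I.n * (I.Δ ^ 2 * I.subα)) ≤ Z W) ≤
        prob I.q (fun W => ∃ c ∈ 𝓒 (S ∩ W),
          I.ε / 25 * (I.n * I.Δ) ≤ ∑ i, (invIndicator I.p S i - 1) * c i) := by
      refine prob_mono hq0 I.q_le_one fun W hW => ?_
      rw [not_le] at hW
      refine ⟨c (S ∩ W) (fun j => y j), Finset.mem_image_of_mem _ (Finset.mem_univ _), ?_⟩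
      set e : V → ℝ := fun i => Real.sqrt (∑ a, I.fieldError S W y i a ^ 2) with he
      have h4 := hcert (S ∩ W) (fun j => y j) (I.X S) (I.X_nonneg S) y e fun i a => by
        refine (hS.abs_field_sub_guess_le W y i a).trans (Real.le_sqrt_of_sq_le ?_)
        rw [sq_abs]
        exact Finset.single_le_sum (f := fun a => I.fieldError S W y i a ^ 2)
          (fun a _ => sq_nonneg _) (Finset.mem_univ a)
      have h5 : ∑ i, (1 + I.X S i) * e i ≤ I.ε / 25 * (I.n * I.Δ) := by
        refine le_of_sq_le_sq ?_ (by positivity)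
        have h6 : (∑ i, (1 + I.X S i) * e i) ^ 2 ≤ (∑ i, (1 + I.X S i)) * Z W := by
          refine Finset.sum_sq_le_sum_mul_sum_of_sq_le_mul _ (fun i _ => ?_) (fun i _ => ?_)
            fun i _ => ?_
          · linarith [I.X_nonneg S i]
          · exact mul_nonneg (by linarith [I.X_nonneg S i])
              (Finset.sum_nonneg fun a _ => sq_nonneg _)
          · rw [mul_pow, he, Real.sq_sqrt (Finset.sum_nonneg fun a _ => sq_nonneg _)]
            exact le_of_eq (by ring)
        have h7 : ∑ i, (1 + I.X S i) ≤ 3 * I.n := by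
          have := hS.sum_X
          rw [δ] at this
          rw [Finset.sum_add_distrib]
          simp only [Finset.sum_const, Finset.card_univ, nsmul_eq_mul, mul_one]
          change I.n + _ ≤ _
          nlinarith
        calc _ ≤ _ := h6
          _ ≤ (3 * I.n) * (16 * (I.n * (I.Δ ^ 2 * I.subα))) := by
              gcongr
              exact hZ0 W
          _ = _ := by rw [subα]; ring
      have h8 : -(4 * I.δ * (I.n * I.Δ)) ≤
          ∑ i, (I.X S i - 1) * (3 * I.deg i + I.ε * I.Δ) := by
        have e1 : ∑ i, (I.X S i - 1) * (3 * I.deg i + I.ε * I.Δ) =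
            3 * ∑ i, (I.X S i - 1) * I.deg i + I.ε * ∑ i, (I.X S i - 1) * I.Δ := by
          rw [Finset.mul_sum, Finset.mul_sum, ← Finset.sum_add_distrib]
          exact Finset.sum_congr rfl fun i _ => by ring
        have h9 := (abs_lt.1 hS.abs_deg).1
        have h10 := (abs_lt.1 hS.2).1
        have h11 : 0 ≤ I.δ * (I.n * I.Δ) := by rw [δ]; positivity
        rw [e1]
        nlinarith
      have hδ : I.δ = I.ε / 200 := rfl
      rw [hδ] at h8
      change _ ≤ ∑ i, (I.X S i - 1) * _
      linarith
    linarith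
  have hcard : ∀ T, ((𝓒 T).card : ℝ) ≤ I.k ^ T.card := by
    intro T
    calc ((𝓒 T).card : ℝ) ≤ (Fintype.card (T → κ) : ℝ) := by
          exact_mod_cast Finset.card_image_le.trans (le_of_eq (Finset.card_univ))
      _ = (Fintype.card κ : ℝ) ^ T.card := by simp
      _ ≤ I.k ^ T.card := by gcongr
  have hc : ∀ T, ∀ x ∈ 𝓒 T, ∃ y, c T y = x := fun T x hx => by
    simpa [𝓒] using hx
  have htwo := two_stage_union_bound (p := I.p) (q := I.q) (𝓒 := 𝓒) (K := I.k)
    (R := 8 * I.Δ ^ 2 * I.α) (L := 8 * (I.n * I.Δ))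
    (lam := I.ε / (400 * (8 * I.Δ ^ 2 * I.α))) (t := I.ε / 25 * (I.n * I.Δ))
    I.p_pos I.p_le_one hq0 I.q_le_one (by linarith [I.one_le_k]) hcard
    (fun T x hx i => by obtain ⟨y, rfl⟩ := hc T x hx; exact hc0 T y i)
    (fun T x hx i => by
      obtain ⟨y, rfl⟩ := hc T x hx
      refine (I.mass_le i).imp id fun h => ?_
      have h1 := hcle T y i
      linarith [I.deg_le_mass i, I.ε_mul_Δ_le_mass i])
    (fun T x hx => by
      obtain ⟨y, rfl⟩ := hc T x hx
      calc ∑ i, c T y i ≤ ∑ i, 2 * (3 * I.deg i + I.ε * I.Δ) :=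
            Finset.sum_le_sum fun i _ => hcle T y i
        _ = 6 * (I.n * I.Δ) + 2 * I.ε * (I.n * I.Δ) := by
            rw [← Finset.mul_sum, Finset.sum_add_distrib, ← Finset.mul_sum, I.sum_deg]
            simp [n]; ring
        _ ≤ _ := by nlinarith)
    (by positivity) (by positivity) (by
      have : I.ε / (400 * (8 * I.Δ ^ 2 * I.α)) * (8 * I.Δ ^ 2 * I.α) = I.ε / 400 := by
        field_simp
      rw [this]; linarith)
  have h1 : prob I.p (fun S => I.Balanced S ∧ ∃ y : V → κ, s + I.ε / 10 * (I.n * I.Δ) <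
      ∑ i, ∑ j, if y i = y j then I.X S i * I.X S j * I.M i j else 0) ≤
      sampleExp I.p (fun S => 2 * prob I.q (fun W => ∃ c ∈ 𝓒 (S ∩ W),
        I.ε / 25 * (I.n * I.Δ) ≤ ∑ i, (invIndicator I.p S i - 1) * c i)) := by
    refine sampleExp_mono I.p_nonneg I.p_le_one fun S => ?_
    split_ifs with h
    · linarith [hgood S h]
    · refine mul_nonneg (by norm_num) (sampleExp_nonneg hq0 I.q_le_one fun W => ?_)
      split_ifs <;> norm_num
  rw [sampleExp_mul_left] at h1
  have h2 := Real.exp_le_exp.2 (I.exponent_le rfl)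
  rw [η]
  linarith

end ImportanceSampling

/-! ### Scores of clusterings and of their restrictions to the sample -/

namespace CorrelationGraph

section Score

variable {V : Type*}

open Classical in
/-- The contribution of the pair `i j` to the score of the clustering `r`. -/
def pairWeight (G : CorrelationGraph V) (r : V → V → Prop) (i j : V) : ℝ :=
  if G.graph.Adj i j then (if r i j then G.cPos i j else G.cNeg i j) else 0

open Classical in
/-- The signed weight `c⁺ - c⁻` of the pair `i j`. -/
def signedWeight (G : CorrelationGraph V) (i j : V) : ℝ :=
  if G.graph.Adj i j then G.cPos i j - G.cNeg i j else 0

theorem pairWeight_nonneg (G : CorrelationGraph V) (r : V → V → Prop) (i j : V) :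
    0 ≤ G.pairWeight r i j := by
  rw [pairWeight]
  split_ifs with h
  · exact G.cPos_nonneg i j h
  · exact G.cNeg_nonneg i j h
  · exact le_rfl

theorem pairWeight_le_abs_signedWeight (G : CorrelationGraph V) (r : V → V → Prop) (i j : V) :
    |G.pairWeight r i j| ≤ |G.signedWeight i j| := by
  rw [abs_of_nonneg (G.pairWeight_nonneg r i j), pairWeight, signedWeight]
  by_cases h : G.graph.Adj i j
  · have h1 := G.cPos_nonneg i j h
    have h2 := G.cNeg_nonneg i j h
    rcases G.eq_zero_or_eq_zero i j h with h0 | h0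
    · simp only [h, h0, if_true, zero_sub, abs_neg]
      rw [abs_of_nonneg h2]
      split_ifs <;> linarith
    · simp only [h, h0, if_true, sub_zero]
      rw [abs_of_nonneg h1]
      split_ifs <;> linarith
  · simp [h]

theorem pairWeight_self (G : CorrelationGraph V) (r : V → V → Prop) (i : V) :
    G.pairWeight r i i = 0 := by
  simp [pairWeight]

open Classical in
theorem pairWeight_eq_add (G : CorrelationGraph V) (r : V → V → Prop) (i j : V) :
    G.pairWeight r i j = G.pairWeight (fun _ _ => False) i j +
      if r i j then G.signedWeight i j else 0 := by
  by_cases h : G.graph.Adj i j <;> by_cases hr : r i j <;> simp [pairWeight, signedWeight, h, hr]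

theorem pairWeight_true_add_false (G : CorrelationGraph V) (i j : V) :
    G.pairWeight (fun _ _ => True) i j + G.pairWeight (fun _ _ => False) i j =
      |G.signedWeight i j| := by
  simp only [pairWeight, signedWeight]
  by_cases h : G.graph.Adj i j
  · have h1 := G.cPos_nonneg i j h
    have h2 := G.cNeg_nonneg i j h
    rcases G.eq_zero_or_eq_zero i j h with h0 | h0
    · simp [h, h0, abs_of_nonneg h2]
    · simp [h, h0, abs_of_nonneg h1]
  · simp [h]

variable [Fintype V]

theorem agreeScore_eq (G : CorrelationGraph V) (r : Setoid V) :
    G.agreeScore r = 1 / 2 * ∑ i, ∑ j, G.pairWeight (fun i j => r i j) i j := rfl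

theorem agreeScore_nonneg (G : CorrelationGraph V) (r : Setoid V) : 0 ≤ G.agreeScore r := by
  rw [agreeScore_eq]
  exact mul_nonneg (by norm_num) (Finset.sum_nonneg fun i _ => Finset.sum_nonneg fun j _ =>
    G.pairWeight_nonneg _ i j)

theorem degree_eq (G : CorrelationGraph V) (i : V) :
    G.degree i = ∑ j, |G.signedWeight i j| := by
  refine Finset.sum_congr rfl fun j _ => ?_
  rw [signedWeight]
  split_ifs <;> simp

theorem agreeScore_le_cc (G : CorrelationGraph V) (r : Setoid V) : G.agreeScore r ≤ G.cc :=
  G.isGreatest_cc.2 ⟨r, rfl⟩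

/-- Merging clusters at random into `k` groups loses each edge between clusters with probability
`1 / k` only, so `k` colors reach a fraction `1 - 1 / k` of any score. -/
theorem exists_coloring_agreeScore_ge (G : CorrelationGraph V) {κ : Type*} [Fintype κ]
    [Nonempty κ] (r : Setoid V) :
    ∃ f : V → κ, (1 - 1 / (Fintype.card κ : ℝ)) * G.agreeScore r ≤
      G.agreeScore (Setoid.ker f) := by
  classical
  have : Fintype (Quotient r) := Fintype.ofFinite _
  set k : ℝ := (Fintype.card κ : ℝ) with hk
  have hk0 : 0 < k := by rw [hk]; exact_mod_cast Fintype.card_pos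
  set N : V → V → ℝ := fun i j =>
    if r i j then 0 else G.pairWeight (fun i j => r i j) i j with hN
  have hN0 : ∀ i j, 0 ≤ N i j := fun i j => by
    simp only [hN]; split_ifs
    · exact le_rfl
    · exact G.pairWeight_nonneg _ i j
  obtain ⟨g, hg⟩ := exists_coloring_ge (z := fun (_ : Quotient r) (_ : κ) => 1 / k)
    (fun _ _ => by positivity) (fun _ => by simp [← hk])
    (fun i : V => (Quotient.mk r i)) (M := fun i j => -N i j) (fun i j h => by
      have : r i j := Quotient.exact h
      simp [hN, this])
  refine ⟨fun i => g (Quotient.mk r i), ?_⟩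
  have h1 : ∑ i, ∑ j, -N i j * ∑ _a : κ, 1 / k * (1 / k) = -(1 / k * ∑ i, ∑ j, N i j) := by
    have : ∑ _a : κ, 1 / k * (1 / k) = 1 / k := by
      rw [Finset.sum_const, Finset.card_univ, nsmul_eq_mul, ← hk]; field_simp
    rw [this]
    simp_rw [neg_mul, Finset.sum_neg_distrib, ← Finset.sum_mul]
    ring
  rw [h1] at hg
  have h2 : ∀ i j, G.pairWeight (fun i j => r i j) i j +
      (if g (Quotient.mk r i) = g (Quotient.mk r j) then -N i j else 0) ≤
      G.pairWeight (fun i j => Setoid.ker (fun i => g (Quotient.mk r i)) i j) i j := by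
    intro i j
    by_cases hr : r i j
    · have hq : Quotient.mk r i = Quotient.mk r j := Quotient.sound hr
      simp [pairWeight, Setoid.ker_def, hN, hr, hq]
    · by_cases hgg : g (Quotient.mk r i) = g (Quotient.mk r j)
      · have := G.pairWeight_nonneg
          (fun i j => Setoid.ker (fun i => g (Quotient.mk r i)) i j) i j
        simpa [hN, hr, hgg] using this
      · simp [pairWeight, Setoid.ker_def, hr, hgg]
  have h3 : ∑ i, ∑ j, N i j ≤ ∑ i, ∑ j, G.pairWeight (fun i j => r i j) i j :=
    Finset.sum_le_sum fun i _ => Finset.sum_le_sum fun j _ => by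
      simp only [hN]; split_ifs
      · exact G.pairWeight_nonneg _ i j
      · exact le_rfl
  have h4 := Finset.sum_le_sum fun i (_ : i ∈ Finset.univ) =>
    Finset.sum_le_sum fun j (_ : j ∈ Finset.univ) => h2 i j
  simp_rw [Finset.sum_add_distrib] at h4
  have h5 : 1 / k * ∑ i, ∑ j, N i j ≤
      1 / k * ∑ i, ∑ j, G.pairWeight (fun i j => r i j) i j := by gcongr
  rw [agreeScore_eq, agreeScore_eq]
  linarith

theorem agreeScore_top_add_bot (G : CorrelationGraph V) :
    G.agreeScore ⊤ + G.agreeScore ⊥ = 1 / 2 * ∑ i, G.degree i := by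
  rw [agreeScore_eq, agreeScore_eq, ← mul_add, ← Finset.sum_add_distrib]
  congr 1
  refine Finset.sum_congr rfl fun i _ => ?_
  rw [degree_eq, ← Finset.sum_add_distrib]
  refine Finset.sum_congr rfl fun j _ => ?_
  rw [← pairWeight_true_add_false]
  congr 1
  -- the trivial relation `⊥` is equality, and a vertex is not adjacent to itself
  by_cases hij : i = j
  · subst hij; rw [pairWeight_self, pairWeight_self]
  · simp [pairWeight, hij]

/-- One of the two trivial clusterings reaches half of the total weight `n Δ / 2`. -/
theorem sum_degree_le_cc (G : CorrelationGraph V) : ∑ i, G.degree i ≤ 4 * G.cc := by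
  linarith [G.agreeScore_top_add_bot, G.agreeScore_le_cc ⊤, G.agreeScore_le_cc ⊥]

/-- The score of the clustering `r` on the sample `S`, where the pair `i j` has weight
`1 / (p i p j)`. -/
def sampleScore (G : CorrelationGraph V) (p : V → ℝ) (S : Finset V) (r : V → V → Prop) : ℝ :=
  1 / 2 * ∑ i, ∑ j, invIndicator p S i * invIndicator p S j * G.pairWeight r i j

open Classical in
theorem sum_invIndicator_mul (p : V → ℝ) (S : Finset V) (f : V → ℝ) :
    ∑ i, invIndicator p S i * f i = ∑ i : S, (p i)⁻¹ * f i := by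
  rw [Finset.sum_coe_sort S (fun i => (p i)⁻¹ * f i), ← Finset.univ_inter S,
    ← Finset.sum_ite_mem, Finset.univ_inter]
  refine Finset.sum_congr rfl fun i _ => ?_
  rw [invIndicator_eq]
  split_ifs <;> simp

/-- The sampled instance, rescaled by `Δ ^ 2`, scores a clustering `rS` of `S` as `sampleScore` scores
any relation on `V` that extends it. -/
theorem agreeScore_vertexSample (G : CorrelationGraph V) (p : V → unitInterval) (S : Finset V)
    (hΔ : 0 < averageDegree G.degree) (r : V → V → Prop) (rS : Setoid S)
    (h : ∀ i j : S, rS i j ↔ r i j) :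
    averageDegree G.degree ^ 2 * (G.vertexSample p S).agreeScore rS =
      G.sampleScore (fun i => (p i : ℝ)) S r := by
  classical
  have h1 : ∑ i, ∑ j, invIndicator (fun i => (p i : ℝ)) S i *
      invIndicator (fun i => (p i : ℝ)) S j * G.pairWeight r i j =
      ∑ i : S, ∑ j : S, (p i : ℝ)⁻¹ * (p j : ℝ)⁻¹ * G.pairWeight r i j := by
    simp_rw [mul_assoc, ← Finset.mul_sum, sum_invIndicator_mul]
  rw [sampleScore, h1, agreeScore_eq, mul_left_comm]
  congr 1
  rw [Finset.mul_sum]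
  refine Finset.sum_congr rfl fun i _ => ?_
  rw [Finset.mul_sum]
  refine Finset.sum_congr rfl fun j _ => ?_
  have hadj : (G.vertexSample p S).graph.Adj i j ↔ G.graph.Adj i j := Iff.rfl
  simp only [pairWeight, hadj, h]
  by_cases ha : G.graph.Adj i j
  · by_cases hr : r i j
    · simp only [ha, hr, if_true, CorrelationGraph.vertexSample]
      rw [one_div, mul_inv, mul_inv]
      field_simp
    · simp only [ha, hr, if_true, if_false, CorrelationGraph.vertexSample]
      rw [one_div, mul_inv, mul_inv]
      field_simp
  · simp [ha]

end Score

end CorrelationGraph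

/-! ### Concentration of all clusterings of the sample -/

namespace CorrelationGraph

variable {V : Type*} [Fintype V] (G : CorrelationGraph V)

theorem two_le_card_of_averageDegree_pos (hΔ : 0 < averageDegree G.degree) :
    2 ≤ Fintype.card V := by
  by_contra! h
  have hs : Subsingleton V := Fintype.card_le_one_iff_subsingleton.1 (by omega)
  have : ∀ i, G.degree i = 0 := fun i => by
    rw [degree_eq]
    refine Finset.sum_eq_zero fun j _ => ?_
    obtain rfl := Subsingleton.elim i j
    simp [signedWeight]
  simp [averageDegree, this] at hΔ

/-- The sampling scheme of a correlation clustering instance: the signed graph is `c⁺ - c⁻`. -/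
def toImportanceSampling (hc : ∀ i j, G.graph.Adj i j → G.cPos i j ≤ 1 ∧ G.cNeg i j ≤ 1)
    (hΔ : 0 < averageDegree G.degree) {ε : ℝ} (hε : 0 < ε) (hε1 : ε < 1) {k : ℝ} (hk : 1 ≤ k)
    {α : ℝ} (hα : 0 < α) (hα' : 10 ^ 12 * k * Real.log (Fintype.card V) * α ≤ ε ^ 4)
    {p : V → unitInterval} (hp : ∀ i, importanceScore G.degree ε α i ≤ p i) :
    ImportanceSampling V where
  two_le_card := G.two_le_card_of_averageDegree_pos hΔ
  M := G.signedWeight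
  symm i j := by
    rw [signedWeight, signedWeight, G.cPos_symm i j, G.cNeg_symm i j]
    by_cases h : G.graph.Adj i j
    · simp [h, h.symm]
    · have h' : ¬ G.graph.Adj j i := fun h' => h h'.symm
      simp [h, h']
  diag i := by simp [signedWeight]
  abs_le_one i j := by
    rw [signedWeight]
    split_ifs with h
    · have h1 := G.cPos_nonneg i j h; have h2 := G.cNeg_nonneg i j h; have h3 := hc i j h
      exact abs_le.2 ⟨by linarith, by linarith⟩
    · simp
  Δ := averageDegree G.degree
  Δ_pos := hΔ
  sum_abs := by
    have h2 := G.two_le_card_of_averageDegree_pos hΔ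
    have h3 : (Fintype.card V : ℝ) ≠ 0 := by
      have : (0 : ℝ) < Fintype.card V := by exact_mod_cast (by omega : 0 < Fintype.card V)
      exact this.ne'
    simp_rw [averageDegree, degree_eq]
    field_simp
  ε := ε
  ε_pos := hε
  ε_lt_one := hε1
  k := k
  one_le_k := hk
  α := α
  α_pos := hα
  hα := hα'
  p i := p i
  p_pos i := by
    refine lt_of_lt_of_le ?_ (hp i)
    rw [importanceScore]
    refine lt_min one_pos (div_pos (lt_max_of_lt_right (mul_pos hε hΔ)) ?_)
    positivity
  p_le_one i := (p i).2.2
  score_le i := by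
    rw [← degree_eq]
    have h := hp i
    rw [importanceScore] at h
    have hs : 0 < averageDegree G.degree ^ 2 * α := by positivity
    rcases min_le_iff.1 h with h1 | h1
    · exact Or.inl (le_antisymm (p i).2.2 h1)
    · rw [div_le_iff₀ hs] at h1
      exact Or.inr (by linarith)

end CorrelationGraph

namespace ImportanceSampling

variable {V : Type*} [Fintype V] (I : ImportanceSampling V)

open Classical in
/-- The sample has at most three times the bound `4 n / (Δ α)` on its expected size. -/
theorem prob_card_le (hp : ∀ i, I.p i ≤ 2 * (I.mass i / (I.Δ ^ 2 * I.α))) :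
    prob I.p (fun S => 12 * (I.n / (I.Δ * I.α)) < (S.card : ℝ)) ≤ I.η := by
  have hε := I.ε_pos; have hΔ := I.Δ_pos; have hε1 := I.ε_lt_one; have hn := I.n_pos
  have hα := I.α_pos
  set μ := 4 * (I.n / (I.Δ * I.α)) with hμ
  have hsum : ∑ i, I.p i ≤ μ := by
    calc ∑ i, I.p i ≤ ∑ i, 2 * ((I.deg i + I.ε * I.Δ) / (I.Δ ^ 2 * I.α)) := by
          refine Finset.sum_le_sum fun i _ => (hp i).trans ?_
          gcongr
          exact max_le (by linarith [I.ε_mul_Δ_pos]) (by linarith [I.deg_nonneg i])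
      _ = 2 * ((I.n * I.Δ + I.n * (I.ε * I.Δ)) / (I.Δ ^ 2 * I.α)) := by
          rw [← Finset.mul_sum, ← Finset.sum_div, Finset.sum_add_distrib, I.sum_deg]; simp [n]
      _ ≤ 2 * ((2 * (I.n * I.Δ)) / (I.Δ ^ 2 * I.α)) := by
          gcongr
          nlinarith [mul_pos hn hΔ]
      _ = μ := by rw [hμ]; field_simp; ring
  have h1 : prob I.p (fun S => 12 * (I.n / (I.Δ * I.α)) < (S.card : ℝ)) ≤
      prob I.p (fun S => 0 ≤ (S.card : ℝ) + -(3 * μ)) :=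
    prob_mono I.p_nonneg I.p_le_one fun S hS => by rw [hμ]; linarith
  refine h1.trans ((prob_le_exp I.p_nonneg I.p_le_one _).trans ?_)
  have h2 : ∀ S : Finset V, Real.exp ((S.card : ℝ) + -(3 * μ)) =
      Real.exp (-(3 * μ)) * ∏ i, if i ∈ S then Real.exp 1 else 1 := by
    intro S
    rw [Real.exp_add, mul_comm, Finset.prod_ite]
    simp [← Real.exp_nat_mul]
  simp_rw [h2]
  rw [sampleExp_mul_left, sampleExp_prod]
  have h3 : ∏ i, (I.p i * Real.exp 1 + (1 - I.p i) * 1) ≤ Real.exp (2 * μ) := by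
    calc _ ≤ ∏ i, Real.exp (2 * I.p i) := by
          refine Finset.prod_le_prod (fun i _ => ?_) fun i _ => ?_
          · have := I.p_nonneg i; have := sub_nonneg.2 (I.p_le_one i); positivity
          · have h4 := Real.exp_one_lt_d9
            have h5 := Real.add_one_le_exp (2 * I.p i)
            nlinarith [I.p_nonneg i]
      _ = Real.exp (2 * ∑ i, I.p i) := by rw [← Real.exp_sum, Finset.mul_sum]
      _ ≤ _ := by gcongr
  calc _ ≤ Real.exp (-(3 * μ)) * Real.exp (2 * μ) := by gcongr
    _ = Real.exp (-μ) := by rw [← Real.exp_add]; congr 1; ring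
    _ ≤ _ := by
        refine I.exp_le_η ?_
        have h4 : 1 ≤ I.n / I.Δ := (one_le_div hΔ).2 I.Δ_le_n
        have h5 : I.ε ^ 3 / (10 ^ 11 * I.α) ≤ 1 / I.α := by
          rw [div_le_div_iff₀ (by positivity) hα]
          have : I.ε ^ 3 ≤ 1 := pow_le_one₀ hε.le hε1.le
          nlinarith
        have h6 : μ = 4 * (1 / I.α * (I.n / I.Δ)) := by rw [hμ]; field_simp
        have h7 : 1 / I.α * 1 ≤ 1 / I.α * (I.n / I.Δ) := by gcongr
        have h8 : 0 < 1 / I.α := by positivity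
        rw [h6]
        linarith

/-- The bad events have total probability `(6 n + 11) η`: one for the size, `2 n + 4` for balance,
`2 n + 2` for each of two matrices, and `2` for the colorings. -/
theorem mul_η_le : (6 * I.n + 11) * I.η ≤ 1 / I.n ^ 2 := by
  have hn := I.two_le_n
  have hn0 := I.n_pos
  have h1 : I.η = (I.n ^ 8)⁻¹ := by
    have : (8 : ℝ) * Real.log I.n = Real.log (I.n ^ 8) := by rw [Real.log_pow]; norm_num
    rw [η, this, Real.exp_neg, Real.exp_log (by positivity)]
  rw [h1, ← div_eq_mul_inv, div_le_div_iff₀ (by positivity) (by positivity)]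
  have h2 : 6 * I.n + 11 ≤ I.n ^ 6 := by
    have : (2 : ℝ) ^ 5 ≤ I.n ^ 5 := by gcongr
    calc 6 * I.n + 11 ≤ I.n * 2 ^ 5 := by linarith
      _ ≤ I.n * I.n ^ 5 := by gcongr
      _ = _ := by ring
  calc _ ≤ I.n ^ 6 * I.n ^ 2 := by gcongr
    _ = _ := by ring

end ImportanceSampling

namespace CorrelationGraph

variable {V : Type*} [Fintype V] (G : CorrelationGraph V)

/-- With probability at least `1 - 1 / n ^ 2` the sample is small, preserves the score of the fixed
clustering `r`, and gives no coloring with palette `κ` a score much above the bound `o` on the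
scores of colorings of the whole graph. -/
theorem prob_preserves_scores_ge
    (hc : ∀ i j, G.graph.Adj i j → G.cPos i j ≤ 1 ∧ G.cNeg i j ≤ 1)
    (hΔ : 0 < averageDegree G.degree) {ε : ℝ} (hε : 0 < ε) (hε1 : ε < 1)
    {κ : Type*} [Fintype κ] [Nonempty κ] {α : ℝ} (hα : 0 < α)
    (hα' : 10 ^ 12 * (Fintype.card κ : ℝ) * Real.log (Fintype.card V) * α ≤ ε ^ 4)
    {p : V → unitInterval} (hp : ∀ i, importanceScore G.degree ε α i ≤ p i ∧
      (p i : ℝ) ≤ 2 * importanceScore G.degree ε α i) (r : Setoid V) {o : ℝ}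
    (ho : ∀ f : V → κ, G.agreeScore (Setoid.ker f) ≤ o) :
    1 - 1 / (Fintype.card V : ℝ) ^ 2 ≤ sampleProb p (fun S =>
      (S.card : ℝ) ≤ 12 * ((Fintype.card V : ℝ) / (averageDegree G.degree * α)) ∧
      |G.sampleScore (fun i => (p i : ℝ)) S (fun i j => r i j) - G.agreeScore r| ≤
        ε / 80 * ∑ i, G.degree i ∧
      ∀ y : V → κ, G.sampleScore (fun i => (p i : ℝ)) S (fun i j => Setoid.ker y i j) ≤
        o + ε / 16 * ∑ i, G.degree i) := by
  classical
  have hk : (1 : ℝ) ≤ Fintype.card κ := by exact_mod_cast Fintype.card_pos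
  let I := G.toImportanceSampling hc hΔ hε hε1 hk hα hα' (fun i => (hp i).1)
  have hsum : ∑ i, G.degree i = I.n * I.Δ := by
    rw [← I.sum_deg]; exact Finset.sum_congr rfl fun i _ => G.degree_eq i
  have hdeg : ∀ i, I.deg i = G.degree i := fun i => (G.degree_eq i).symm
  set w := G.pairWeight (fun i j => r i j) with hw
  set N := G.pairWeight (fun _ _ => False) with hN
  set s := 2 * o - ∑ i, ∑ j, N i j with hs
  -- the sum of a coloring splits into the constant `N` and the monochromatic signed weight
  have hsplit : ∀ (X : V → V → ℝ) (y : V → κ),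
      ∑ i, ∑ j, X i j * G.pairWeight (fun i j => Setoid.ker y i j) i j =
      ∑ i, ∑ j, X i j * N i j + ∑ i, ∑ j, if y i = y j then X i j * I.M i j else 0 := by
    intro X y
    rw [← Finset.sum_add_distrib]
    refine Finset.sum_congr rfl fun i _ => ?_
    rw [← Finset.sum_add_distrib]
    refine Finset.sum_congr rfl fun j _ => ?_
    rw [pairWeight_eq_add, mul_add, Setoid.ker_def]
    congr 1
    split_ifs <;> simp [I, toImportanceSampling]
  have hs' : ∀ f : V → κ, ∑ i, ∑ j, (if f i = f j then I.M i j else 0) ≤ s := by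
    intro f
    have h1 := ho f
    rw [agreeScore_eq] at h1
    have h2 := hsplit (fun _ _ => 1) f
    simp only [one_mul] at h2
    rw [hs]; linarith
  set Bad : Finset V → Prop := fun S => I.Balanced S ∧ ∃ y : V → κ,
    s + I.ε / 10 * (I.n * I.Δ) <
      ∑ i, ∑ j, if y i = y j then I.X S i * I.X S j * I.M i j else 0 with hBad
  have b1 := I.prob_not_balanced_le
  have b2 := I.prob_not_spread_le (w := w) (G.pairWeight_le_abs_signedWeight _)
  have b3 := I.prob_not_spread_le (w := N) (G.pairWeight_le_abs_signedWeight _)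
  have b4 : prob I.p Bad ≤ 2 * I.η := I.prob_balanced_and_exceeds_le le_rfl hs'
  have b5 := I.prob_card_le fun i => by
    refine (hp i).2.trans ?_
    have : importanceScore G.degree ε α i ≤ I.mass i / (I.Δ ^ 2 * I.α) := by
      rw [ImportanceSampling.mass, hdeg]
      exact min_le_right _ _
    linarith
  have b6 := I.mul_η_le
  rw [sampleProb_eq_prob]
  set Good : Finset V → Prop := fun S =>
      (S.card : ℝ) ≤ 12 * ((Fintype.card V : ℝ) / (averageDegree G.degree * α)) ∧
      |G.sampleScore (fun i => (p i : ℝ)) S (fun i j => r i j) - G.agreeScore r| ≤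
        ε / 80 * ∑ i, G.degree i ∧
      ∀ y : V → κ, G.sampleScore (fun i => (p i : ℝ)) S (fun i j => Setoid.ker y i j) ≤
        o + ε / 16 * ∑ i, G.degree i with hGood
  have hdet : ∀ S, ¬ Good S → ¬ I.Balanced S ∨ (¬ I.Spread w S ∨ (¬ I.Spread N S ∨
      (Bad S ∨ 12 * (I.n / (I.Δ * I.α)) < (S.card : ℝ)))) := by
    intro S hS
    by_contra! hcon
    obtain ⟨c1, c2, c3, c4, c5⟩ := hcon
    refine hS ⟨c5, ?_, fun y => ?_⟩
    · have h1 := c1.abs_quadratic_sub_le c2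
      rw [hsum, sampleScore, agreeScore_eq, ← mul_sub, abs_mul, abs_of_pos (by norm_num)]
      change 1 / 2 * |∑ i, ∑ j, I.X S i * I.X S j * w i j - ∑ i, ∑ j, w i j| ≤
        I.ε / 80 * _
      linarith
    · have h1 := (abs_le.1 (c1.abs_quadratic_sub_le c3)).2
      have h2 : ∑ i, ∑ j, (if y i = y j then I.X S i * I.X S j * I.M i j else 0) ≤
          s + I.ε / 10 * (I.n * I.Δ) := by
        by_contra! h
        exact c4 ⟨c1, y, h⟩
      have h3 := hsplit (fun i j => I.X S i * I.X S j) y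
      rw [hsum, sampleScore]
      change 1 / 2 * ∑ i, ∑ j, I.X S i * I.X S j *
        G.pairWeight (fun i j => Setoid.ker y i j) i j ≤ o + I.ε / 16 * (I.n * I.Δ)
      rw [h3]
      rw [hs] at h2
      linarith
  have u1 : prob I.p (fun S => ¬ Good S) ≤ (6 * I.n + 11) * I.η := by
    refine (prob_mono I.p_nonneg I.p_le_one hdet).trans ?_
    refine (prob_or_le I.p_nonneg I.p_le_one _ _).trans ?_
    have v1 := prob_or_le I.p_nonneg I.p_le_one (fun S => ¬ I.Spread w S)
      (fun S => ¬ I.Spread N S ∨ (Bad S ∨ 12 * (I.n / (I.Δ * I.α)) < (S.card : ℝ)))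
    have v2 := prob_or_le I.p_nonneg I.p_le_one (fun S => ¬ I.Spread N S)
      (fun S => Bad S ∨ 12 * (I.n / (I.Δ * I.α)) < (S.card : ℝ))
    have v3 := prob_or_le I.p_nonneg I.p_le_one Bad
      (fun S => 12 * (I.n / (I.Δ * I.α)) < (S.card : ℝ))
    linarith
  have u2 := prob_add_prob_not I.p Good
  change 1 - 1 / I.n ^ 2 ≤ prob I.p Good
  linarith

end CorrelationGraph

/-! ### Correlation clustering -/

section Extend

variable {V κ : Type*} [Nonempty κ]

open Classical in
theorem exists_extension (S : Finset V) (f : S → κ) : ∃ y : V → κ, ∀ i : S, y i = f i :=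
  ⟨fun i => if h : i ∈ S then f ⟨i, h⟩ else Classical.arbitrary κ, fun i => by simp⟩

end Extend

theorem sampleProb_mono {V : Type*} [Fintype V] (p : V → unitInterval) {E F : Finset V → Prop}
    (h : ∀ S, E S → F S) : sampleProb p E ≤ sampleProb p F := by
  rw [sampleProb_eq_prob, sampleProb_eq_prob]
  exact prob_mono (fun i => (p i).2.1) (fun i => (p i).2.2) h

namespace CorrelationGraph

variable {V : Type*} [Fintype V] (G : CorrelationGraph V)

theorem log_card_pos (hΔ : 0 < averageDegree G.degree) : 0 < Real.log (Fintype.card V) :=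
  Real.log_pos (by exact_mod_cast G.two_le_card_of_averageDegree_pos hΔ)

/-- The clustering guarantee for the sample, with `⌈4 / ε⌉` colors in place of arbitrary
clusterings. -/
theorem prob_cc_withinFactor_ge
    (hc : ∀ i j, G.graph.Adj i j → G.cPos i j ≤ 1 ∧ G.cNeg i j ≤ 1)
    (hΔ : 0 < averageDegree G.degree) {ε : ℝ} (hε : 0 < ε) (hε1 : ε < 1) {C : ℝ}
    (hC : 5 * 10 ^ 12 ≤ C) {p : V → unitInterval}
    (hp : ∀ i, importanceScore G.degree ε (ε ^ 8 / (C * Real.log (Fintype.card V))) i ≤ p i ∧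
      (p i : ℝ) ≤ 2 * importanceScore G.degree ε (ε ^ 8 / (C * Real.log (Fintype.card V))) i) :
    1 - 1 / (Fintype.card V : ℝ) ^ 2 ≤ sampleProb p (fun S =>
      (S.card : ℝ) ≤ 12 * C * (Real.log (Fintype.card V) / ε ^ 8) *
        ((Fintype.card V : ℝ) / averageDegree G.degree) ∧
      WithinFactor (1 + ε) (averageDegree G.degree ^ 2 * (G.vertexSample p S).cc) G.cc) := by
  classical
  have hlog := G.log_card_pos hΔ
  have hC0 : 0 < C := by linarith
  set k := ⌈4 / ε⌉₊ with hk
  have hk4 : 4 / ε ≤ k := Nat.le_ceil _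
  have hk5 : (k : ℝ) ≤ 5 / ε := by
    have h1 : (k : ℝ) < 4 / ε + 1 := Nat.ceil_lt_add_one (by positivity)
    have h2 : 1 ≤ 1 / ε := (one_le_div hε).2 hε1.le
    have h3 : 4 / ε + 1 / ε = 5 / ε := by ring
    linarith
  have hk0 : 0 < k := Nat.ceil_pos.2 (by positivity)
  have : Nonempty (Fin k) := ⟨⟨0, hk0⟩⟩
  have hα' : 10 ^ 12 * (Fintype.card (Fin k) : ℝ) * Real.log (Fintype.card V) *
      (ε ^ 8 / (C * Real.log (Fintype.card V))) ≤ ε ^ 4 := by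
    rw [Fintype.card_fin]
    calc _ = 10 ^ 12 * k * ε ^ 8 / C := by field_simp
      _ ≤ 10 ^ 12 * (5 / ε) * ε ^ 8 / C := by gcongr
      _ = 5 * 10 ^ 12 / C * ε ^ 7 := by field_simp
      _ ≤ 1 * ε ^ 4 := by
          gcongr ?_ * ?_
          · exact (div_le_one hC0).2 hC
          · exact pow_le_pow_of_le_one hε.le hε1.le (by norm_num)
      _ = _ := one_mul _
  obtain ⟨⟨r, hr⟩, -⟩ := G.isGreatest_cc
  refine (G.prob_preserves_scores_ge hc hΔ hε hε1 (κ := Fin k) (by positivity) hα' hp r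
    (o := G.cc) (fun f => G.agreeScore_le_cc _)).trans (sampleProb_mono p ?_)
  rintro S ⟨hcard, hlow, hup⟩
  have hdeg := G.sum_degree_le_cc
  have hcc : 0 ≤ G.cc := hr ▸ G.agreeScore_nonneg r
  refine ⟨hcard.trans (le_of_eq ?_), ?_, ?_⟩
  · field_simp
  · obtain ⟨⟨rS, hrS⟩, -⟩ := (G.vertexSample p S).isGreatest_cc
    obtain ⟨f, hf⟩ := (G.vertexSample p S).exists_coloring_agreeScore_ge (κ := Fin k) rS
    obtain ⟨y, hy⟩ := exists_extension S f
    have h1 := G.agreeScore_vertexSample p S hΔ (fun i j => Setoid.ker y i j) (Setoid.ker f)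
      fun i j => by rw [Setoid.ker_def, Setoid.ker_def, hy, hy]
    have h2 := hup y
    rw [← h1] at h2
    rw [hrS, Fintype.card_fin] at hf
    set A := averageDegree G.degree ^ 2 * (G.vertexSample p S).cc with hA
    have hA0 : 0 ≤ A := by
      rw [hA, ← hrS]
      exact mul_nonneg (sq_nonneg _) (agreeScore_nonneg _ _)
    have h3 : (1 - 1 / (k : ℝ)) * A ≤ G.cc + ε / 4 * G.cc := by
      calc (1 - 1 / (k : ℝ)) * A = averageDegree G.degree ^ 2 *
            ((1 - 1 / (k : ℝ)) * (G.vertexSample p S).cc) := by rw [hA]; ring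
        _ ≤ averageDegree G.degree ^ 2 * (G.vertexSample p S).agreeScore (Setoid.ker f) := by
            gcongr
        _ ≤ _ := h2
        _ ≤ _ := by nlinarith
    have h4 : 1 / (k : ℝ) ≤ ε / 4 := by
      rw [div_le_iff₀ (by exact_mod_cast hk0)]
      rw [div_le_iff₀ hε] at hk4
      linarith
    have h5 : (1 - ε / 4) * A ≤ (1 + ε / 4) * G.cc := by nlinarith
    have h6 : (1 + ε / 4) * G.cc ≤ (1 - ε / 4) * ((1 + ε) * G.cc) := by
      nlinarith [mul_nonneg hε.le hcc]
    exact le_of_mul_le_mul_left (h5.trans h6) (by linarith)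
  · have h1 := G.agreeScore_vertexSample p S hΔ (fun i j => r i j)
      (r.comap (Subtype.val : S → V)) fun i j => Iff.rfl
    have h2 := (abs_le.1 hlow).1
    have h3 := (G.vertexSample p S).agreeScore_le_cc (r.comap (Subtype.val : S → V))
    have h4 := mul_le_mul_of_nonneg_left h3 (sq_nonneg (averageDegree G.degree))
    rw [hr] at h2
    have h5 : (1 - ε / 20) * G.cc ≤
        averageDegree G.degree ^ 2 * (G.vertexSample p S).cc := by nlinarith
    calc G.cc ≤ (1 + ε) * ((1 - ε / 20) * G.cc) := by nlinarith [mul_nonneg hε.le hcc]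
      _ ≤ _ := by gcongr

end CorrelationGraph

/-! ### Maximum cut -/

namespace WeightedGraph

variable {V : Type*} [Fintype V]

theorem cutWeight_le_maxCut (H : WeightedGraph V) (A : Set V) : H.cutWeight A ≤ H.maxCut :=
  H.isGreatest_maxCut.2 ⟨A, rfl⟩

open Classical in
/-- A cut weight is half the sum over ordered pairs, like a clustering score. -/
theorem cutWeight_eq (H : WeightedGraph V) (A : Set V) :
    H.cutWeight A = 1 / 2 * ∑ i, ∑ j, if H.graph.Adj i j then
      (if (Setoid.ker fun i => i ∈ A) i j then 0 else H.weight i j) else 0 := by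
  have h : ∑ i, ∑ j, (if H.graph.Adj i j then
      (if (Setoid.ker fun i => i ∈ A) i j then 0 else H.weight i j) else 0) =
      H.cutWeight A + ∑ i, ∑ j,
        if j ∈ A ∧ i ∉ A ∧ H.graph.Adj j i then H.weight j i else 0 := by
    rw [cutWeight, ← Finset.sum_add_distrib]
    refine Finset.sum_congr rfl fun i _ => ?_
    rw [← Finset.sum_add_distrib]
    refine Finset.sum_congr rfl fun j _ => ?_
    rw [H.weight_symm j i, H.graph.adj_comm j i]
    by_cases ha : H.graph.Adj i j <;> by_cases hi : i ∈ A <;> by_cases hj : j ∈ A <;>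
      simp [Setoid.ker_def, ha, hi, hj]
  rw [Finset.sum_comm (f := fun i j =>
    if j ∈ A ∧ i ∉ A ∧ H.graph.Adj j i then H.weight j i else 0)] at h
  rw [h, cutWeight]
  ring

end WeightedGraph

namespace SimpleGraph

variable {V : Type*} [Fintype V] (G : SimpleGraph V)

/-- Maximum cut as correlation clustering: every edge prefers different clusters. -/
def cutInstance {V : Type*} (G : SimpleGraph V) : CorrelationGraph V where
  graph := G
  cPos _ _ := 0
  cNeg _ _ := 1
  cPos_symm _ _ := rfl
  cNeg_symm _ _ := rfl
  cPos_nonneg _ _ _ := le_rfl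
  cNeg_nonneg _ _ _ := zero_le_one
  eq_zero_or_eq_zero _ _ _ := Or.inl rfl

theorem degree_cutInstance : G.cutInstance.degree = vertexDegree G := by
  classical
  funext i
  rw [vertexDegree, ← G.card_neighborFinset_eq_degree, CorrelationGraph.degree]
  simp [cutInstance, Finset.sum_boole, neighborFinset_eq_filter]

theorem cutWeight_ofSimpleGraph (A : Set V) :
    (WeightedGraph.ofSimpleGraph G).cutWeight A =
      G.cutInstance.agreeScore (Setoid.ker fun i => i ∈ A) := by
  rw [WeightedGraph.cutWeight_eq, CorrelationGraph.agreeScore]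
  rfl

theorem cutWeight_vertexSample (p : V → unitInterval) (S : Finset V) (A : Set S) :
    (vertexSample G p S).cutWeight A =
      (G.cutInstance.vertexSample p S).agreeScore (Setoid.ker fun i => i ∈ A) := by
  classical
  rw [WeightedGraph.cutWeight_eq, CorrelationGraph.agreeScore]
  congr 1
  refine Finset.sum_congr rfl fun i _ => Finset.sum_congr rfl fun j _ => ?_
  have hadj : (G.cutInstance.vertexSample p S).graph.Adj i j ↔
    (vertexSample G p S).graph.Adj i j := Iff.rfl
  have hpos : (G.cutInstance.vertexSample p S).cPos i j = 0 := mul_zero _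
  have hneg : (G.cutInstance.vertexSample p S).cNeg i j = (vertexSample G p S).weight i j := by
    simp only [CorrelationGraph.vertexSample, _root_.vertexSample, degree_cutInstance]
    exact mul_one _
  simp only [hadj, hpos, hneg]

theorem sum_vertexDegree_le_maxCut :
    ∑ i, vertexDegree G i ≤ 4 * (WeightedGraph.ofSimpleGraph G).maxCut := by
  classical
  obtain ⟨f, hf⟩ := G.cutInstance.exists_coloring_agreeScore_ge (κ := Prop) ⊥
  have h1 := (WeightedGraph.ofSimpleGraph G).cutWeight_le_maxCut {i | f i}
  rw [cutWeight_ofSimpleGraph] at h1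
  change G.cutInstance.agreeScore (Setoid.ker f) ≤ _ at h1
  have h2 := G.cutInstance.agreeScore_top_add_bot
  have h3 : G.cutInstance.agreeScore ⊤ = 0 := by
    rw [CorrelationGraph.agreeScore]
    simp [cutInstance]
  rw [degree_cutInstance] at h2
  rw [Fintype.card_prop] at hf
  norm_num at hf
  linarith

/-- The cut guarantee for the sample: cuts are colorings with two colors. -/
theorem prob_maxCut_withinFactor_ge (hΔ : 0 < averageDegree (vertexDegree G)) {ε : ℝ}
    (hε : 0 < ε) (hε1 : ε < 1) {C : ℝ} (hC : 2 * 10 ^ 12 ≤ C) {p : V → unitInterval}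
    (hp : ∀ i, importanceScore (vertexDegree G) ε
        (ε ^ 4 / (C * Real.log (Fintype.card V))) i ≤ p i ∧
      (p i : ℝ) ≤ 2 * importanceScore (vertexDegree G) ε
        (ε ^ 4 / (C * Real.log (Fintype.card V))) i) :
    1 - 1 / (Fintype.card V : ℝ) ^ 2 ≤ sampleProb p (fun S =>
      (S.card : ℝ) ≤ 12 * C * (Real.log (Fintype.card V) / ε ^ 4) *
        ((Fintype.card V : ℝ) / averageDegree (vertexDegree G)) ∧
      WithinFactor (1 + ε)
        (averageDegree (vertexDegree G) ^ 2 * (vertexSample G p S).maxCut)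
        (WeightedGraph.ofSimpleGraph G).maxCut) := by
  classical
  have hdeg := G.sum_vertexDegree_le_maxCut
  set m := (WeightedGraph.ofSimpleGraph G).maxCut with hm
  rw [← degree_cutInstance] at hΔ hp hdeg ⊢
  have hlog := G.cutInstance.log_card_pos hΔ
  have hC0 : 0 < C := by linarith
  have hα' : 10 ^ 12 * (Fintype.card Prop : ℝ) * Real.log (Fintype.card V) *
      (ε ^ 4 / (C * Real.log (Fintype.card V))) ≤ ε ^ 4 := by
    rw [Fintype.card_prop]
    calc _ = 2 * 10 ^ 12 / C * ε ^ 4 := by push_cast; field_simp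
      _ ≤ 1 * ε ^ 4 := by gcongr; exact (div_le_one hC0).2 hC
      _ = _ := one_mul _
  obtain ⟨⟨A, hA⟩, -⟩ := (WeightedGraph.ofSimpleGraph G).isGreatest_maxCut
  rw [← hm, cutWeight_ofSimpleGraph] at hA
  have hm0 : 0 ≤ m := hA ▸ CorrelationGraph.agreeScore_nonneg _ _
  refine (G.cutInstance.prob_preserves_scores_ge (fun _ _ _ => ⟨zero_le_one, le_rfl⟩) hΔ hε hε1
    (κ := Prop) (by positivity) hα' hp (Setoid.ker fun i => i ∈ A) (o := m)
    (fun f => ?_)).trans (sampleProb_mono p ?_)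
  · have h := (WeightedGraph.ofSimpleGraph G).cutWeight_le_maxCut {i | f i}
    rw [cutWeight_ofSimpleGraph] at h
    exact h
  rintro S ⟨hcard, hlow, hup⟩
  refine ⟨hcard.trans (le_of_eq ?_), ?_, ?_⟩
  · field_simp
  · obtain ⟨⟨B, hB⟩, -⟩ := (vertexSample G p S).isGreatest_maxCut
    obtain ⟨y, hy⟩ := exists_extension S (fun i => i ∈ B)
    have h1 := G.cutInstance.agreeScore_vertexSample p S hΔ (fun i j => Setoid.ker y i j)
      (Setoid.ker fun i => i ∈ B) fun i j => by rw [Setoid.ker_def, Setoid.ker_def, hy, hy]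
    have h2 := hup y
    rw [← h1, ← cutWeight_vertexSample, hB] at h2
    nlinarith [mul_nonneg hε.le hm0]
  · have h1 := G.cutInstance.agreeScore_vertexSample p S hΔ
      (fun i j => Setoid.ker (fun i => i ∈ A) i j)
      (Setoid.ker fun i : S => i ∈ {i : S | (i : V) ∈ A}) fun i j => Iff.rfl
    have h2 := (abs_le.1 hlow).1
    have h3 := (vertexSample G p S).cutWeight_le_maxCut {i : S | (i : V) ∈ A}
    rw [cutWeight_vertexSample] at h3
    have h4 := mul_le_mul_of_nonneg_left h3 (sq_nonneg (averageDegree G.cutInstance.degree))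
    rw [hA] at h2
    have h5 : (1 - ε / 20) * m ≤
        averageDegree G.cutInstance.degree ^ 2 * (vertexSample G p S).maxCut := by nlinarith
    calc m ≤ (1 + ε) * ((1 - ε / 20) * m) := by nlinarith [mul_nonneg hε.le hm0]
      _ ≤ _ := by gcongr

end SimpleGraph

end

theorem theorem4p2 :
    ∃ C K : ℝ, 0 < C ∧ 0 < K ∧
      ∀ (V : Type*) [Fintype V] (ε : ℝ), 0 < ε → ε < 1 →
        -- maximum cut, with `α = ε⁴ / (C log n)`
        (∀ (G : SimpleGraph V) (p : V → unitInterval),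
          0 < averageDegree (vertexDegree G) →
          (∀ i, importanceScore (vertexDegree G) ε
              (ε ^ 4 / (C * Real.log (Fintype.card V))) i ≤ p i ∧
            (p i : ℝ) ≤ 2 * importanceScore (vertexDegree G) ε
              (ε ^ 4 / (C * Real.log (Fintype.card V))) i) →
          1 - 1 / (Fintype.card V : ℝ) ^ 2 ≤
            sampleProb p (fun S =>
              (S.card : ℝ) ≤ K * (Real.log (Fintype.card V) / ε ^ 4) *
                ((Fintype.card V : ℝ) / averageDegree (vertexDegree G)) ∧
              WithinFactor (1 + ε)
                (averageDegree (vertexDegree G) ^ 2 * (vertexSample G p S).maxCut)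
                (WeightedGraph.ofSimpleGraph G).maxCut)) ∧
        -- correlation clustering, with `α = ε⁸ / (C log n)`
        (∀ (G : CorrelationGraph V) (p : V → unitInterval),
          (∀ i j, G.graph.Adj i j → G.cPos i j ≤ 1 ∧ G.cNeg i j ≤ 1) →
          0 < averageDegree G.degree →
          (∀ i, importanceScore G.degree ε
              (ε ^ 8 / (C * Real.log (Fintype.card V))) i ≤ p i ∧
            (p i : ℝ) ≤ 2 * importanceScore G.degree ε
              (ε ^ 8 / (C * Real.log (Fintype.card V))) i) →
          1 - 1 / (Fintype.card V : ℝ) ^ 2 ≤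
            sampleProb p (fun S =>
              (S.card : ℝ) ≤ K * (Real.log (Fintype.card V) / ε ^ 8) *
                ((Fintype.card V : ℝ) / averageDegree G.degree) ∧
              WithinFactor (1 + ε)
                (averageDegree G.degree ^ 2 * (G.vertexSample p S).cc)
                G.cc)) := by
  refine ⟨5 * 10 ^ 12, 12 * (5 * 10 ^ 12), by norm_num, by norm_num, fun V _ ε hε hε1 => ⟨?_, ?_⟩⟩
  · intro G p hΔ hp
    exact G.prob_maxCut_withinFactor_ge hΔ hε hε1 (by norm_num) hp
  · intro G p hc hΔ hp
    exact G.prob_cc_withinFactor_ge hc hΔ hε hε1 le_rfl hp
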